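/- Let $k_1,k_2$ be integers with $0\le k_1\le k_2$ and $\gcd(k_1,k_2)=1$, and put $\Gamma=k_1^2+k_2^2+k_1k_2$. Let $\mathsf S^1_{\vec k}\subset\mathsf{SU}(3)$ be the image of $z\mapsto\operatorname{diag}(z^{-(k_1+k_2)},z^{k_1},z^{k_2})$, $|z|=1$, with Lie algebra $\mathfrak h$, and let $W^7_{k_1,k_2}=\mathsf{SU}(3)/\mathsf S^1_{\vec k}$ be the Aloff--Wallach space. Equip $\mathfrak{su}(3)$ with the bi-invariant inner product $\langle\!\langle X,Y\rangle\!\rangle=-\tfrac12\operatorname{tr}(XY)$, so that $\mathfrak h^\perp=\mathfrak p_0\oplus\mathfrak p_1\oplus\mathfrak p_2\oplus\mathfrak p_3$ orthogonally, where $\mathfrak p_0$ is spanned over $\mathbb R$ by $\operatorname{diag}((k_1-k_2)i,(2k_2+k_1)i,-(2k_1+k_2)i)$, $\mathfrak p_1=\operatorname{span}_{\mathbb R}\{E_{23},F_{23}\}$, $\mathfrak p_2=\operatorname{span}_{\mathbb R}\{E_{13},F_{13}\}$, $\mathfrak p_3=\operatorname{span}_{\mathbb R}\{E_{12},F_{12}\}$.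 Here $E_{jk}$ has entry $1$ in position $(j,k)$, $-1$ in position $(k,j)$ and $0$ elsewhere, and $F_{jk}$ has entry $i$ in positions $(j,k)$ and $(k,j)$ and $0$ elsewhere. For $t,s_0,s_1,s_2>0$ let $\langle\cdot,\cdot\rangle_{t,\vec s}$ be the $\mathsf{SU}(3)$-invariant Riemannian metric on $W^7_{k_1,k_2}$ which on the tangent space $\mathfrak h^\perp$ at the origin equals $$t\,\langle\!\langle\cdot,\cdot\rangle\!\rangle|_{\mathfrak p_0}+s_0\,\langle\!\langle\cdot,\cdot\rangle\!\rangle|_{\mathfrak p_1}+s_1\,\langle\!\langle\cdot,\cdot\rangle\!\rangle|_{\mathfrak p_2}+s_2\,\langle\!\langle\cdot,\cdot\rangle\!\rangle|_{\mathfrak p_3}.$$ Then the Ricci tensor of $\langle\cdot,\cdot\rangle_{t,\vec s}$ is the $\mathsf{SU}(3)$-invariant tensor which at the origin equals $$t\,r_0\,\langle\!\langle\cdot,\cdot\rangle\!\rangle|_{\mathfrak p_0}+s_0\,r_1\,\langle\!\langle\cdot,\cdot\rangle\!\rangle|_{\mathfrak p_1}+s_1\,r_2\,\langle\!\langle\cdot,\cdot\rangle\!\rangle|_{\mathfrak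 p_2}+s_2\,r_3\,\langle\!\langle\cdot,\cdot\rangle\!\rangle|_{\mathfrak p_3}$$ for exactly one quadruple of real numbers $r_0,\dots,r_3$ (the Ricci eigenvalues), namely \begin{align*} r_0&=\frac{3t}{2\Gamma}\left(\frac{(k_1+k_2)^2}{s_0^2}+\frac{k_1^2}{s_1^2}+\frac{k_2^2}{s_2^2}\right),\\ r_1&=\frac6{s_0}-\frac{3(k_1+k_2)^2t}{2\Gamma s_0^2}+\left(\frac{s_0}{s_1s_2}-\frac{s_1}{s_0s_2}-\frac{s_2}{s_0s_1}\right),\\ r_2&=\frac6{s_1}-\frac{3k_1^2t}{2\Gamma s_1^2}+\left(\frac{s_1}{s_0s_2}-\frac{s_0}{s_1s_2}-\frac{s_2}{s_0s_1}\right),\\ r_3&=\frac6{s_2}-\frac{3k_2^2t}{2\Gamma s_2^2}+\left(\frac{s_2}{s_0s_1}-\frac{s_0}{s_1s_2}-\frac{s_1}{s_0s_2}\right). \end{align*} -/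

import Mathlib

open scoped ContDiff

namespace AloffWallach

noncomputable section

/-! ## Ricci curvature in local coordinates -/

/-- The partial derivative `∂ᵢ f` at `x`. -/
def partialDeriv {n : ℕ} (i : Fin n) (f : (Fin n → ℝ) → ℝ) (x : Fin n → ℝ) : ℝ :=
  fderiv ℝ f x (Pi.single i 1)

/-- The Christoffel symbol `Γᵏᵢⱼ = ½ ∑ₗ gᵏˡ (∂ᵢ gⱼₗ + ∂ⱼ gᵢₗ - ∂ₗ gᵢⱼ)` of the Levi-Civita
connection of a Riemannian metric with coordinate matrix `g`. -/
def christoffel {n : ℕ} (g : (Fin n → ℝ) → Matrix (Fin n) (Fin n) ℝ) (k i j : Fin n)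
    (x : Fin n → ℝ) : ℝ :=
  (1 / 2) * ∑ l, (g x)⁻¹ k l *
    (partialDeriv i (fun y => g y j l) x + partialDeriv j (fun y => g y i l) x
      - partialDeriv l (fun y => g y i j) x)

/-- The component `Ricⱼₖ` of the Ricci tensor `Ric(Y, Z) = tr (X ↦ R(X, Y) Z)`, that is
`∑ᵢ (∂ᵢ Γⁱⱼₖ - ∂ⱼ Γⁱᵢₖ + ∑ₚ (Γⁱᵢₚ Γᵖⱼₖ - Γⁱⱼₚ Γᵖᵢₖ))`. -/
def ricci {n : ℕ} (g : (Fin n → ℝ) → Matrix (Fin n) (Fin n) ℝ) (j k : Fin n)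
    (x : Fin n → ℝ) : ℝ :=
  ∑ i, (partialDeriv i (christoffel g i j k) x - partialDeriv j (christoffel g i i k) x
    + ∑ p, (christoffel g i i p x * christoffel g p j k x
      - christoffel g i j p x * christoffel g p i k x))

/-! ## The Aloff-Wallach spaces -/

/-- Complex `3 × 3` matrices. -/
abbrev Mat3 : Type := Matrix (Fin 3) (Fin 3) ℂ

/-- The group `SU(3)`. -/
abbrev SU3 : Type := Matrix.specialUnitaryGroup (Fin 3) ℂ

/-- The integer vector `(k₀, k₁, k₂)` with `k₀ = -(k₁ + k₂)`. -/
def kvec (k₁ k₂ : ℕ) : Fin 3 → ℤ := ![-((k₁ : ℤ) + k₂), k₁, k₂]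

/-- The homomorphism `z ↦ diag (z ^ k₀, z ^ k₁, z ^ k₂)` from the circle to `SU(3)`. -/
def circleHom (k₁ k₂ : ℕ) : Circle →* SU3 where
  toFun z := ⟨Matrix.diagonal fun a => ((z ^ kvec k₁ k₂ a : Circle) : ℂ), by
    rw [Matrix.mem_specialUnitaryGroup_iff]
    constructor
    · rw [Matrix.mem_unitaryGroup_iff, Matrix.star_eq_conjTranspose,
        Matrix.diagonal_conjTranspose, Matrix.diagonal_mul_diagonal, ← Matrix.diagonal_one]
      congr 1
      funext a
      simp only [Pi.star_apply, RCLike.star_def, Complex.mul_conj, Complex.normSq_eq_norm_sq,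
        Circle.norm_coe, one_pow, Complex.ofReal_one]
    · rw [Matrix.det_diagonal, Fin.prod_univ_three]
      simp only [← Circle.coe_mul, ← zpow_add]
      simp [kvec]⟩
  map_one' := by
    apply Subtype.ext
    simp
  map_mul' z w := by
    apply Subtype.ext
    simp [mul_zpow, Matrix.diagonal_mul_diagonal]

/-- The circle subgroup `S¹ₖ` of `SU(3)`. -/
def circleSubgroup (k₁ k₂ : ℕ) : Subgroup SU3 := (circleHom k₁ k₂).range

/-- The Aloff-Wallach space `SU(3) / S¹ₖ`. -/
abbrev Space (k₁ k₂ : ℕ) : Type := SU3 ⧸ circleSubgroup k₁ k₂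

/-- The Lie algebra of `S¹ₖ`, spanned by `diag (-(k₁ + k₂) i, k₁ i, k₂ i)`. -/
def isotropy (k₁ k₂ : ℕ) : Submodule ℝ Mat3 :=
  Submodule.span ℝ {Matrix.diagonal fun a => (kvec k₁ k₂ a : ℂ) * Complex.I}

/-- The pulled back Maurer-Cartan form `φ(x)⁻¹ (dφ)ₓ(v)` of a map `φ` into `SU(3)`. -/
def maurerCartan {n : ℕ} (φ : (Fin n → ℝ) → SU3) (x v : Fin n → ℝ) : Mat3 :=
  (((φ x)⁻¹ : SU3) : Mat3) *
    Matrix.of fun a b => fderiv ℝ (fun y => ((φ y : SU3) : Mat3) a b) x v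

/-- A smooth local parametrization of the seven-dimensional manifold `SU(3) / S¹ₖ`: a map from an
open set of `ℝ⁷` together with a smooth lift `φ` to `SU(3)`. Identifying the tangent space at
`g S¹ₖ` with `𝔰𝔲(3) / 𝔥` by the translation with `g⁻¹`, the differential of `x ↦ φ(x) S¹ₖ` is
`v ↦ φ(x)⁻¹ (dφ)ₓ(v) + 𝔥`; it is required to be injective (hence bijective). Since
`SU(3) → SU(3) / S¹ₖ` is a submersion, every chart is locally the inverse of such a map. -/
structure LocalParam (k₁ k₂ : ℕ) where
  source : Set (Fin 7 → ℝ)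
  isOpen_source : IsOpen source
  toFun : (Fin 7 → ℝ) → Space k₁ k₂
  lift : (Fin 7 → ℝ) → SU3
  lift_spec : ∀ x ∈ source, (QuotientGroup.mk (lift x) : Space k₁ k₂) = toFun x
  smooth : ∀ a b, ContDiffOn ℝ ∞ (fun x => ((lift x : SU3) : Mat3) a b) source
  immersion : ∀ x ∈ source, ∀ v, maurerCartan lift x v ∈ isotropy k₁ k₂ → v = 0

/-! ## The diagonal metrics -/

/-- The bi-invariant inner product `-½ Re tr (X Y)` on `𝔰𝔲(3)`. -/
def ip (X Y : Mat3) : ℝ := -(1 / 2) * (X * Y).trace.re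

/-- The number `Γ = k₁² + k₂² + k₁ k₂`. -/
def Gam (k₁ k₂ : ℕ) : ℝ := (k₁ : ℝ) ^ 2 + (k₂ : ℝ) ^ 2 + (k₁ : ℝ) * k₂

/-- `1` in position `(j, k)`, `-1` in position `(k, j)`. -/
def matE (j k : Fin 3) : Mat3 := Matrix.single j k 1 - Matrix.single k j 1

/-- `i` in the positions `(j, k)` and `(k, j)`. -/
def matF (j k : Fin 3) : Mat3 := Matrix.single j k Complex.I + Matrix.single k j Complex.I

/-- The unit vector `diag ((k₁ - k₂) i, (2 k₂ + k₁) i, -(2 k₁ + k₂) i) / √(3 Γ)`. -/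
def matT (k₁ k₂ : ℕ) : Mat3 :=
  (1 / Real.sqrt (3 * Gam k₁ k₂)) • Matrix.diagonal
    ![((k₁ : ℂ) - k₂) * Complex.I, (2 * (k₂ : ℂ) + k₁) * Complex.I,
      -(2 * (k₁ : ℂ) + k₂) * Complex.I]

/-- The orthogonal projection of `𝔰𝔲(3)` onto the summand `𝔭ₐ` of `𝔥^⊥ = 𝔭₀ ⊕ 𝔭₁ ⊕ 𝔭₂ ⊕ 𝔭₃`,
written in an orthonormal basis of `𝔭ₐ`. Matrix indices run through `0, 1, 2`, so
`𝔭₁ = span {E₂₃, F₂₃}`, `𝔭₂ = span {E₁₃, F₁₃}` and `𝔭₃ = span {E₁₂, F₁₂}` in the usual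
one-based notation. -/
def proj (k₁ k₂ : ℕ) (a : Fin 4) (X : Mat3) : Mat3 :=
  ![ip X (matT k₁ k₂) • matT k₁ k₂,
    ip X (matE 1 2) • matE 1 2 + ip X (matF 1 2) • matF 1 2,
    ip X (matE 0 2) • matE 0 2 + ip X (matF 0 2) • matF 0 2,
    ip X (matE 0 1) • matE 0 1 + ip X (matF 0 1) • matF 0 1] a

/-- The symmetric bilinear form `c₀ ⟪·,·⟫|𝔭₀ + c₁ ⟪·,·⟫|𝔭₁ + c₂ ⟪·,·⟫|𝔭₂ + c₃ ⟪·,·⟫|𝔭₃` on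
`𝔥^⊥ ≅ 𝔰𝔲(3) / 𝔥`, extended to `𝔰𝔲(3)` with `𝔥` in its kernel. -/
def diagForm (k₁ k₂ : ℕ) (c : Fin 4 → ℝ) (X Y : Mat3) : ℝ :=
  ∑ a, c a * ip (proj k₁ k₂ a X) (proj k₁ k₂ a Y)

/-- The coordinate matrix, in a local parametrization, of the `SU(3)`-invariant symmetric bilinear
form on `SU(3) / S¹ₖ` whose value at the origin is `diagForm k₁ k₂ c`. -/
def LocalParam.coordMatrix {k₁ k₂ : ℕ} (P : LocalParam k₁ k₂) (c : Fin 4 → ℝ)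
    (x : Fin 7 → ℝ) : Matrix (Fin 7) (Fin 7) ℝ :=
  Matrix.of fun i j => diagForm k₁ k₂ c
    (maurerCartan P.lift x (Pi.single i 1)) (maurerCartan P.lift x (Pi.single j 1))

/-- The coordinate matrix of the `SU(3)`-invariant Riemannian metric `⟨·,·⟩_{t, s}`, which equals
`t ⟪·,·⟫|𝔭₀ + s₀ ⟪·,·⟫|𝔭₁ + s₁ ⟪·,·⟫|𝔭₂ + s₂ ⟪·,·⟫|𝔭₃` at the origin. -/
def LocalParam.metric {k₁ k₂ : ℕ} (P : LocalParam k₁ k₂) (t : ℝ) (s : Fin 3 → ℝ) :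
    (Fin 7 → ℝ) → Matrix (Fin 7) (Fin 7) ℝ :=
  P.coordMatrix ![t, s 0, s 1, s 2]

/-- `r₀, r₁, r₂, r₃` are the Ricci eigenvalues of `⟨·,·⟩_{t, s}`: the Ricci tensor is everywhere
the invariant form with value
`t r₀ ⟪·,·⟫|𝔭₀ + s₀ r₁ ⟪·,·⟫|𝔭₁ + s₁ r₂ ⟪·,·⟫|𝔭₂ + s₂ r₃ ⟪·,·⟫|𝔭₃` at the origin, i.e. the Ricci
endomorphism is multiplication by `rₐ` on `𝔭ₐ`. -/
def IsRicciEigenvalues (k₁ k₂ : ℕ) (t : ℝ) (s : Fin 3 → ℝ) (r : Fin 4 → ℝ) : Prop :=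
  ∀ P : LocalParam k₁ k₂, ∀ x ∈ P.source, ∀ i j : Fin 7,
    ricci (P.metric t s) i j x =
      P.coordMatrix ![t * r 0, s 0 * r 1, s 1 * r 2, s 2 * r 3] x i j

end

end AloffWallach

/-! The proof is Cartan's method of moving frames, pulled back along the lift `φ` of a local
parametrization. Split the Maurer-Cartan form `φ⁻¹dφ` into its coordinates `θ` along an orthonormal
frame of `𝔥^⊥` and its coordinate `η` along the generator of `𝔥`. In coordinates the metric is `θᵀ D
θ` with `D` constant and diagonal, and `d(φ⁻¹dφ) = -φ⁻¹dφ ∧ φ⁻¹dφ` expresses `dθ` and `dη` through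
constants: the structure constants `C` of `𝔥^⊥`, the adjoint action `h` of `𝔥`, and the `𝔥`-part `κ`
of the brackets.

Koszul's formula suggests the connection form `A = ∑ θᵃ Lₐ + η h` with constant matrices `Lₐ`. It is
metric and torsion free, so `coframe_mul_christoffelMatrix` identifies it, in the frame `θ`, with
the Christoffel symbols. Its curvature is `∑ θᵇ ∧ θᵈ` with coefficients `[L_b, L_d] - ∑ Cᶜ_bd L_c -
κ_bd h`; the terms in `η` cancel because `h` acts equivariantly on the `Lₐ`. So the Ricci tensor is
`θᵀ ρ θ` for a constant matrix `ρ` (`ricci_eq_of_structure_equations`), and geometry is reduced to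
algebra in `𝔰𝔲(3)`.

By total antisymmetry of `C`, each entry of `ρ` is one contraction of two structure constants plus
an isotropy term (`sum_curvature`). Off the diagonal it vanishes. On the diagonal the only further
input is that every root has squared length `4`, which is `α² + β²/Γ = 4` for the weights `α` of
`𝔭₀` and `β` of `𝔥`.

This proves that the stated numbers are Ricci eigenvalues. That no others are requires at least one
local parametrization, since the definition quantifies over all of them; a product of seven curves
in `SU(3)` provides one. -/

namespace AloffWallach

open Filter Topology Matrix

/-! ### Entrywise calculus of matrix valued functions -/

section MatrixCalculus

variable {V : Type*} [NormedAddCommGroup V] [NormedSpace ℝ V]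
variable {𝕜 : Type*} [NormedField 𝕜] [NormedAlgebra ℝ 𝕜]
variable {l m p : Type*}

/-- The entrywise directional derivative of a matrix valued function. -/
noncomputable def matDeriv (v : V) (M : V → Matrix l m 𝕜) (x : V) : Matrix l m 𝕜 :=
  Matrix.of fun a b => fderiv ℝ (fun y => M y a b) x v

/-- Entrywise smoothness at a point of a matrix valued function. -/
def MatSmoothAt (M : V → Matrix l m 𝕜) (x : V) : Prop :=
  ∀ a b, ContDiffAt ℝ ∞ (fun y => M y a b) x

theorem MatSmoothAt.differentiableAt {M : V → Matrix l m 𝕜} {x : V} (h : MatSmoothAt M x)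
    (a : l) (b : m) : DifferentiableAt ℝ (fun y => M y a b) x :=
  (h a b).differentiableAt (by simp)

theorem MatSmoothAt.congr {M N : V → Matrix l m 𝕜} {x : V} (h : MatSmoothAt M x)
    (e : N =ᶠ[𝓝 x] M) : MatSmoothAt N x := fun a b =>
  (h a b).congr_of_eventuallyEq (e.mono fun _ hy => congrFun (congrFun hy a) b)

theorem matSmoothAt_const (M : Matrix l m 𝕜) (x : V) : MatSmoothAt (fun _ => M) x :=
  fun _ _ => contDiffAt_const

theorem MatSmoothAt.add {M N : V → Matrix l m 𝕜} {x : V} (hM : MatSmoothAt M x)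
    (hN : MatSmoothAt N x) : MatSmoothAt (fun y => M y + N y) x :=
  fun a b => (hM a b).add (hN a b)

theorem MatSmoothAt.transpose {M : V → Matrix l m 𝕜} {x : V} (hM : MatSmoothAt M x) :
    MatSmoothAt (fun y => (M y)ᵀ) x :=
  fun a b => hM b a

theorem MatSmoothAt.mul [Fintype m] {M : V → Matrix l m 𝕜} {N : V → Matrix m p 𝕜} {x : V}
    (hM : MatSmoothAt M x) (hN : MatSmoothAt N x) : MatSmoothAt (fun y => M y * N y) x := by
  intro a b
  simp only [Matrix.mul_apply]
  exact ContDiffAt.sum fun c _ => (hM a c).mul (hN c b)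

theorem MatSmoothAt.conjTranspose {M : V → Matrix l m ℂ} {x : V} (hM : MatSmoothAt M x) :
    MatSmoothAt (fun y => (M y)ᴴ) x := by
  intro a b
  exact Complex.conjCLE.contDiff.contDiffAt.comp x (hM b a)

theorem MatSmoothAt.det [Fintype m] [DecidableEq m] {M : V → Matrix m m 𝕜} {x : V}
    (hM : MatSmoothAt M x) : ContDiffAt ℝ ∞ (fun y => (M y).det) x := by
  simp only [Matrix.det_apply, Units.smul_def, zsmul_eq_mul]
  exact ContDiffAt.sum fun σ _ => contDiffAt_const.mul (contDiffAt_prod fun i _ => hM _ _)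

/-- Cramer's rule: entries of the inverse are determinants divided by a nonvanishing determinant. -/
theorem MatSmoothAt.inv [Fintype m] [DecidableEq m] {M : V → Matrix m m ℝ} {x : V}
    (hM : MatSmoothAt M x) (hx : (M x).det ≠ 0) : MatSmoothAt (fun y => (M y)⁻¹) x := by
  intro a b
  simp only [Matrix.inv_def, Ring.inverse_eq_inv', Matrix.smul_apply, smul_eq_mul,
    Matrix.adjugate_apply]
  refine (hM.det.inv hx).mul (MatSmoothAt.det fun i j => ?_)
  by_cases hi : i = b
  · subst hi
    simpa only [Matrix.updateRow_self] using contDiffAt_const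
  · simpa only [Matrix.updateRow_ne hi] using hM i j

theorem MatSmoothAt.matDeriv {M : V → Matrix l m 𝕜} {x : V} (hM : MatSmoothAt M x) (v : V) :
    MatSmoothAt (matDeriv v M) x := fun a b =>
  ((hM a b).fderiv_right (m := ∞) (by simp)).clm_apply contDiffAt_const

theorem matDeriv_congr {M N : V → Matrix l m 𝕜} {x : V} (e : M =ᶠ[𝓝 x] N) (v : V) :
    matDeriv v M x = matDeriv v N x := by
  ext a b
  have : (fun y => M y a b) =ᶠ[𝓝 x] fun y => N y a b := e.mono fun y hy => by
    simp only [hy]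
  simp only [matDeriv, Matrix.of_apply, this.fderiv_eq]

theorem matDeriv_const (M : Matrix l m 𝕜) (x v : V) : matDeriv v (fun _ => M) x = 0 := by
  ext a b
  simp [matDeriv]

theorem matDeriv_add {M N : V → Matrix l m 𝕜} {x : V} (hM : MatSmoothAt M x)
    (hN : MatSmoothAt N x) (v : V) :
    matDeriv v (fun y => M y + N y) x = matDeriv v M x + matDeriv v N x := by
  ext a b
  simp only [matDeriv, Matrix.of_apply, Matrix.add_apply]
  rw [fderiv_fun_add (hM.differentiableAt a b) (hN.differentiableAt a b)]
  rfl

theorem matDeriv_transpose (M : V → Matrix l m 𝕜) (x v : V) :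
    matDeriv v (fun y => (M y)ᵀ) x = (matDeriv v M x)ᵀ := rfl

theorem matDeriv_mul [Fintype m] {M : V → Matrix l m 𝕜} {N : V → Matrix m p 𝕜} {x : V}
    (hM : MatSmoothAt M x) (hN : MatSmoothAt N x) (v : V) :
    matDeriv v (fun y => M y * N y) x = matDeriv v M x * N x + M x * matDeriv v N x := by
  ext a b
  simp only [matDeriv, Matrix.of_apply, Matrix.add_apply, Matrix.mul_apply]
  rw [fderiv_fun_sum fun c _ => (hM.differentiableAt a c).fun_mul (hN.differentiableAt c b),
    _root_.sum_apply, ← Finset.sum_add_distrib]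
  refine Finset.sum_congr rfl fun c _ => ?_
  rw [fderiv_fun_mul (hM.differentiableAt a c) (hN.differentiableAt c b)]
  simp only [_root_.add_apply, _root_.smul_apply, smul_eq_mul]
  ring

theorem matDeriv_conjTranspose {M : V → Matrix l m ℂ} {x : V} (hM : MatSmoothAt M x) (v : V) :
    matDeriv v (fun y => (M y)ᴴ) x = (matDeriv v M x)ᴴ := by
  ext a b
  have h := (Complex.conjCLE.hasFDerivAt (x := M x b a)).comp x
    (hM.differentiableAt b a).hasFDerivAt
  simp only [matDeriv, Matrix.of_apply, Matrix.conjTranspose_apply]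
  exact DFunLike.congr_fun h.fderiv v

theorem matDeriv_comm {M : V → Matrix l m 𝕜} {x : V} (hM : MatSmoothAt M x) (v w : V) :
    matDeriv v (matDeriv w M) x = matDeriv w (matDeriv v M) x := by
  ext a b
  have hs : IsSymmSndFDerivAt ℝ (fun y => M y a b) x :=
    (contDiffAt_infty.1 (hM a b) 2).isSymmSndFDerivAt (by simp)
  have hd : DifferentiableAt ℝ (fderiv ℝ fun y => M y a b) x :=
    ((hM a b).fderiv_right (m := ∞) (by simp)).differentiableAt (by simp)
  have key : ∀ u : V, fderiv ℝ (fun y => fderiv ℝ (fun y => M y a b) y u) x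
      = (fderiv ℝ (fderiv ℝ fun y => M y a b) x).flip u := fun u => by
    rw [fderiv_clm_apply hd (differentiableAt_const u)]
    simp
  simp only [matDeriv, Matrix.of_apply, key]
  exact hs v w

theorem MatSmoothAt.linear [Fintype l] [Fintype m] (φ : (l → m → ℂ) →ₗ[ℝ] ℝ)
    {M : V → Matrix l m ℂ} {x : V} (hM : MatSmoothAt M x) :
    ContDiffAt ℝ ∞ (fun y => φ (M y)) x :=
  φ.toContinuousLinearMap.contDiff.contDiffAt.comp x
    (contDiffAt_pi.2 fun a => contDiffAt_pi.2 fun b => hM a b)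

theorem fderiv_linear_matrix [Fintype l] [Fintype m] (φ : (l → m → ℂ) →ₗ[ℝ] ℝ)
    {M : V → Matrix l m ℂ} {x : V} (hM : MatSmoothAt M x) (v : V) :
    fderiv ℝ (fun y => φ (M y)) x v = φ (matDeriv v M x) := by
  have h : HasFDerivAt (fun y a b => M y a b)
      (ContinuousLinearMap.pi fun a => ContinuousLinearMap.pi fun b =>
        fderiv ℝ (fun y => M y a b) x) x :=
    hasFDerivAt_pi.2 fun a => hasFDerivAt_pi.2 fun b => (hM.differentiableAt a b).hasFDerivAt
  exact DFunLike.congr_fun (φ.toContinuousLinearMap.hasFDerivAt.comp x h).fderiv v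

end MatrixCalculus

end AloffWallach

namespace AloffWallach

open Filter Topology Matrix

/-! ### Levi-Civita connection and curvature in a moving coframe -/

section MovingFrames

variable {n : ℕ} {U : Set (Fin n → ℝ)} {θ : (Fin n → ℝ) → Matrix (Fin n) (Fin n) ℝ}
  {A : Fin n → (Fin n → ℝ) → Matrix (Fin n) (Fin n) ℝ} {D : Fin n → ℝ}
  {g : (Fin n → ℝ) → Matrix (Fin n) (Fin n) ℝ}

/-- The matrix `(Γᵏᵢⱼ)ₖⱼ` of the Levi-Civita connection in the direction `∂ᵢ`. -/
noncomputable def christoffelMatrix (g : (Fin n → ℝ) → Matrix (Fin n) (Fin n) ℝ) (i : Fin n)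
    (x : Fin n → ℝ) : Matrix (Fin n) (Fin n) ℝ :=
  Matrix.of fun k j => christoffel g k i j x

/-- A metric and torsion free connection in a moving coframe is the Levi-Civita connection. -/
theorem coframe_mul_christoffelMatrix (hU : IsOpen U) (hD : ∀ a, D a ≠ 0)
    (hθ : ∀ x ∈ U, MatSmoothAt θ x) (hdet : ∀ x ∈ U, (θ x).det ≠ 0)
    (hmetric : ∀ x ∈ U, ∀ i, (A i x)ᵀ * diagonal D = -(diagonal D * A i x))
    (htorsion : ∀ x ∈ U, ∀ i j a,
      (matDeriv (Pi.single i 1) θ x + A i x * θ x) a j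
        = (matDeriv (Pi.single j 1) θ x + A j x * θ x) a i)
    (hg : ∀ x ∈ U, g x = (θ x)ᵀ * diagonal D * θ x) {x : Fin n → ℝ} (hx : x ∈ U) (i : Fin n) :
    θ x * christoffelMatrix g i x = matDeriv (Pi.single i 1) θ x + A i x * θ x := by
  set W : Fin n → Matrix (Fin n) (Fin n) ℝ :=
    fun i => matDeriv (Pi.single i 1) θ x + A i x * θ x with hW
  set S : Fin n → Matrix (Fin n) (Fin n) ℝ := fun i => (θ x)ᵀ * diagonal D * W i with hS
  -- The terms in `A` that are added to `∂ᵢ(θᵀ D θ)` cancel, because `A` is skew for `D`.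
  have hdg : ∀ i, matDeriv (Pi.single i 1) g x = (S i)ᵀ + S i := fun i => by
    have e : g =ᶠ[𝓝 x] fun y => (θ y)ᵀ * diagonal D * θ y :=
      Filter.eventually_of_mem (hU.mem_nhds hx) hg
    have h1 : MatSmoothAt (fun y => (θ y)ᵀ * diagonal D) x :=
      (hθ x hx).transpose.mul (matSmoothAt_const _ x)
    rw [matDeriv_congr e, matDeriv_mul h1 (hθ x hx),
      matDeriv_mul (hθ x hx).transpose (matSmoothAt_const _ x), matDeriv_const,
      matDeriv_transpose]
    simp only [hS, hW, Matrix.transpose_mul, Matrix.transpose_add, Matrix.transpose_transpose,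
      Matrix.diagonal_transpose, Matrix.mul_add, Matrix.mul_zero, add_zero]
    have h2 := congrArg (fun M => (θ x)ᵀ * M * θ x) (hmetric x hx i)
    simp only [Matrix.mul_neg, Matrix.neg_mul, ← Matrix.mul_assoc] at h2
    simp only [← Matrix.mul_assoc]
    rw [h2]
    abel
  -- The `S` play the role of Christoffel symbols of the first kind; vanishing torsion is their
  -- symmetry in the lower indices.
  have hsymm : ∀ i j l, S i l j = S j l i := fun i j l => by
    simp only [hS, Matrix.mul_apply]
    exact Finset.sum_congr rfl fun a _ => congrArg _ (htorsion x hx i j a)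
  -- Koszul's argument: in the cyclic combination of derivatives of `g`, four of the six terms
  -- cancel by symmetry and `2 S` remains.
  have hΓ : christoffelMatrix g i x = (g x)⁻¹ * S i := by
    ext k j
    have hpd : ∀ i j l, partialDeriv i (fun y => g y j l) x = S i l j + S i j l := fun i j l =>
      congrFun (congrFun (hdg i) j) l
    simp only [christoffelMatrix, Matrix.of_apply, christoffel, hpd, Matrix.mul_apply,
      Finset.mul_sum]
    refine Finset.sum_congr rfl fun l _ => ?_
    rw [hsymm j i l, hsymm i l j, hsymm j l i]
    ring
  have hDdet : IsUnit (diagonal D).det := by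
    rw [Matrix.det_diagonal]
    exact (Finset.prod_ne_zero_iff.2 fun a _ => hD a).isUnit
  have hθdet : IsUnit (θ x).det := (hdet x hx).isUnit
  rw [hΓ, hg x hx, Matrix.mul_inv_rev, Matrix.mul_inv_rev, ← Matrix.mul_assoc,
    Matrix.mul_nonsing_inv_cancel_left _ _ hθdet, hS]
  simp only [Matrix.mul_assoc]
  rw [Matrix.nonsing_inv_mul_cancel_left _ _ (by rwa [Matrix.det_transpose]),
    Matrix.nonsing_inv_mul_cancel_left _ _ hDdet]

/-- The gauge transformation rule of the curvature. -/
theorem coframe_mul_curvature (hU : IsOpen U)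
    (hθ : ∀ x ∈ U, MatSmoothAt θ x) (hdet : ∀ x ∈ U, (θ x).det ≠ 0)
    (hA : ∀ x ∈ U, ∀ i, MatSmoothAt (A i) x)
    {G : Fin n → (Fin n → ℝ) → Matrix (Fin n) (Fin n) ℝ}
    (hG : ∀ x ∈ U, ∀ i, θ x * G i x = matDeriv (Pi.single i 1) θ x + A i x * θ x)
    {x : Fin n → ℝ} (hx : x ∈ U) (i j : Fin n) :
    θ x * (matDeriv (Pi.single i 1) (G j) x - matDeriv (Pi.single j 1) (G i) x
        + (G i x * G j x - G j x * G i x))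
      = (matDeriv (Pi.single i 1) (A j) x - matDeriv (Pi.single j 1) (A i) x
        + (A i x * A j x - A j x * A i x)) * θ x := by
  have hs := hθ x hx
  -- Smoothness of `G` is not assumed: it follows by solving the gauge relation for `G` near `x`.
  have hGs : ∀ i, MatSmoothAt (G i) x := fun i => by
    have e : G i =ᶠ[𝓝 x] fun y =>
        (θ y)⁻¹ * (matDeriv (Pi.single i 1) θ y + A i y * θ y) := by
      filter_upwards [hU.mem_nhds hx] with y hy
      rw [← hG y hy i, Matrix.nonsing_inv_mul_cancel_left _ _ (hdet y hy).isUnit]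
    exact ((hs.inv (hdet x hx)).mul ((hs.matDeriv _).add ((hA x hx i).mul hs))).congr e
  have hd : ∀ i j : Fin n, matDeriv (Pi.single j 1) θ x * G i x
      + θ x * matDeriv (Pi.single j 1) (G i) x
      = matDeriv (Pi.single j 1) (matDeriv (Pi.single i 1) θ) x
        + (matDeriv (Pi.single j 1) (A i) x * θ x
          + A i x * matDeriv (Pi.single j 1) θ x) := fun i j => by
    have e : (fun y => θ y * G i y) =ᶠ[𝓝 x] fun y =>
        matDeriv (Pi.single i 1) θ y + A i y * θ y :=
      Filter.eventually_of_mem (hU.mem_nhds hx) fun y hy => hG y hy i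
    rw [← matDeriv_mul hs (hGs i), matDeriv_congr e,
      matDeriv_add (hs.matDeriv _) ((hA x hx i).mul hs), matDeriv_mul (hA x hx i) hs]
  have hij := hd i j
  have hji := hd j i
  have hGi := eq_sub_of_add_eq (hG x hx i).symm
  have hGj := eq_sub_of_add_eq (hG x hx j).symm
  -- The mixed second derivatives of `θ` are the only second-order terms; made equal here, they
  -- cancel in the final subtraction.
  rw [matDeriv_comm hs] at hij
  generalize matDeriv (Pi.single i 1) (matDeriv (Pi.single j 1) θ) x = H at hij hji
  rw [hGj] at hij
  rw [hGi] at hji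
  generalize matDeriv (Pi.single j 1) (G i) x = G1 at *
  generalize matDeriv (Pi.single i 1) (G j) x = G2 at *
  generalize matDeriv (Pi.single j 1) (A i) x = A1 at *
  generalize matDeriv (Pi.single i 1) (A j) x = A2 at *
  have e1 := eq_sub_of_add_eq' hij
  have e2 := eq_sub_of_add_eq' hji
  rw [Matrix.mul_add, Matrix.mul_sub, e1, e2]
  noncomm_ring

/-- Ricci is the trace, over the first form index and the upper index, of the curvature matrix `∂ᵢΓⱼ
- ∂ⱼΓᵢ + [Γᵢ, Γⱼ]`. -/
theorem ricci_eq_sum_christoffelMatrix (j k : Fin n) (x : Fin n → ℝ) :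
    ricci g j k x = ∑ i, (matDeriv (Pi.single i 1) (christoffelMatrix g j) x
      - matDeriv (Pi.single j 1) (christoffelMatrix g i) x
      + (christoffelMatrix g i x * christoffelMatrix g j x
        - christoffelMatrix g j x * christoffelMatrix g i x)) i k := by
  simp only [ricci, Matrix.add_apply, Matrix.sub_apply, Matrix.mul_apply,
    ← Finset.sum_sub_distrib]
  rfl

/-- The Ricci tensor of a diagonal metric in a moving coframe whose Levi-Civita connection form is
`∑ₐ θᵃ Lₐ + η h`, where `h` generates the isotropy and `C`, `κ` are structure constants. -/
theorem ricci_eq_of_structure_equations {L : Fin n → Matrix (Fin n) (Fin n) ℝ}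
    {h : Matrix (Fin n) (Fin n) ℝ} {C : Fin n → Matrix (Fin n) (Fin n) ℝ}
    {κ ρ : Matrix (Fin n) (Fin n) ℝ} {η : (Fin n → ℝ) → Fin n → ℝ}
    (hU : IsOpen U) (hD : ∀ a, D a ≠ 0)
    (hθ : ∀ x ∈ U, MatSmoothAt θ x) (hdet : ∀ x ∈ U, (θ x).det ≠ 0)
    (hη : ∀ x ∈ U, ∀ i, ContDiffAt ℝ ∞ (fun y => η y i) x)
    (hLmetric : ∀ a, (L a)ᵀ * diagonal D = -(diagonal D * L a))
    (hhmetric : hᵀ * diagonal D = -(diagonal D * h))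
    (htorsion : ∀ a b c, L b a c - L c a b = C a b c)
    (hequiv : ∀ b, h * L b - L b * h = ∑ c, h c b • L c)
    (hρ : ∀ d b, ∑ a, (L a * L d - L d * L a - ∑ c, C c a d • L c - κ a d • h) a b = ρ d b)
    (hdθ : ∀ x ∈ U, ∀ i j a, matDeriv (Pi.single i 1) θ x a j - matDeriv (Pi.single j 1) θ x a i
      = -(∑ b, ∑ d, C a b d * θ x b i * θ x d j)
        - (η x i * (h * θ x) a j - η x j * (h * θ x) a i))
    (hdη : ∀ x ∈ U, ∀ i j, partialDeriv i (fun y => η y j) x - partialDeriv j (fun y => η y i) x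
      = -∑ b, ∑ d, κ b d * θ x b i * θ x d j)
    (hg : ∀ x ∈ U, g x = (θ x)ᵀ * diagonal D * θ x) {x : Fin n → ℝ} (hx : x ∈ U) (j k : Fin n) :
    ricci g j k x = ((θ x)ᵀ * ρ * θ x) j k := by
  set A : Fin n → (Fin n → ℝ) → Matrix (Fin n) (Fin n) ℝ :=
    fun i y => ∑ a, θ y a i • L a + η y i • h with hAdef
  have hA : ∀ x ∈ U, ∀ i, MatSmoothAt (A i) x := fun x hx i a b => by
    simp only [hAdef, Matrix.add_apply, Matrix.sum_apply, Matrix.smul_apply, smul_eq_mul]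
    exact (ContDiffAt.sum fun c _ => (hθ x hx c i).mul contDiffAt_const).add
      ((hη x hx i).mul contDiffAt_const)
  have hAθ : ∀ x i j a, (A i x * θ x) a j
      = ∑ b, ∑ d, L b a d * θ x b i * θ x d j + η x i * (h * θ x) a j := fun x i j a => by
    simp only [hAdef, Matrix.add_mul, Matrix.add_apply, Matrix.smul_mul, Matrix.smul_apply,
      smul_eq_mul, Matrix.sum_mul, Matrix.sum_apply]
    congr 1
    refine Finset.sum_congr rfl fun b _ => ?_
    rw [Matrix.mul_apply, Finset.mul_sum]
    exact Finset.sum_congr rfl fun d _ => by ring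
  have hG := fun x (hx : x ∈ U) i => coframe_mul_christoffelMatrix (A := A) hU hD hθ hdet
    (fun x hx i => by
      simp only [hAdef, Matrix.transpose_add, Matrix.transpose_sum, Matrix.transpose_smul,
        Matrix.add_mul, Matrix.mul_add, Matrix.sum_mul, Matrix.mul_sum, Matrix.smul_mul,
        Matrix.mul_smul, hLmetric, hhmetric, smul_neg, Finset.sum_neg_distrib, neg_add])
    (fun x hx i j a => by
      have h1 := hdθ x hx i j a
      have h2 : ∑ b, ∑ d, C a b d * θ x b i * θ x d j
          = ∑ b, ∑ d, L b a d * θ x b i * θ x d j - ∑ b, ∑ d, L b a d * θ x b j * θ x d i := by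
        rw [Finset.sum_comm (f := fun b d => L b a d * θ x b j * θ x d i)]
        simp only [← Finset.sum_sub_distrib, ← htorsion]
        exact Finset.sum_congr rfl fun b _ => Finset.sum_congr rfl fun d _ => by ring
      simp only [Matrix.add_apply, hAθ]
      linarith) hg hx i
  -- The coefficients of the curvature form of `A`; they are constant in `x`.
  set Φ : Fin n → Fin n → Matrix (Fin n) (Fin n) ℝ := fun b d =>
    L b * L d - L d * L b - ∑ c, C c b d • L c - κ b d • h with hΦ
  have hdA : ∀ i j, matDeriv (Pi.single i 1) (A j) x
      = ∑ c, matDeriv (Pi.single i 1) θ x c j • L c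
        + partialDeriv i (fun y => η y j) x • h := fun i j => by
    ext a b
    have hdθ' : ∀ c, DifferentiableAt ℝ (fun y => θ y c j * L c a b) x := fun c =>
      ((hθ x hx).differentiableAt c j).mul_const _
    have hdη' : DifferentiableAt ℝ (fun y => η y j) x := (hη x hx j).differentiableAt (by simp)
    simp only [matDeriv, Matrix.of_apply, hAdef, Matrix.add_apply, Matrix.sum_apply,
      Matrix.smul_apply, smul_eq_mul, partialDeriv]
    rw [fderiv_fun_add (DifferentiableAt.fun_sum fun c _ => hdθ' c) (hdη'.mul_const _),
      fderiv_fun_sum fun c _ => hdθ' c, fderiv_mul_const hdη', _root_.add_apply,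
      _root_.sum_apply, _root_.smul_apply, smul_eq_mul, mul_comm]
    congr 1
    refine Finset.sum_congr rfl fun c _ => ?_
    rw [fderiv_mul_const ((hθ x hx).differentiableAt c j), _root_.smul_apply, smul_eq_mul,
      mul_comm]
  -- This commutator is what cancels the `η`-terms coming from `dθ`, so that the choice of lift
  -- leaves no trace in the curvature.
  have hcomm : ∀ j, h * (∑ a, θ x a j • L a) - (∑ a, θ x a j • L a) * h
      = ∑ c, (h * θ x) c j • L c := fun j => by
    simp only [Matrix.mul_sum, Matrix.sum_mul, Matrix.mul_smul, Matrix.smul_mul,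
      ← Finset.sum_sub_distrib, ← smul_sub, hequiv, Finset.smul_sum, Matrix.mul_apply,
      Finset.sum_smul, smul_smul]
    rw [Finset.sum_comm]
    exact Finset.sum_congr rfl fun b _ => Finset.sum_congr rfl fun d _ => by rw [mul_comm]
  have hF : ∀ i, matDeriv (Pi.single i 1) (A j) x - matDeriv (Pi.single j 1) (A i) x
      + (A i x * A j x - A j x * A i x) = ∑ b, θ x b i • ∑ d, θ x d j • Φ b d := fun i => by
    have h1 : ∑ c, matDeriv (Pi.single i 1) θ x c j • L c
        - ∑ c, matDeriv (Pi.single j 1) θ x c i • L c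
        = -(∑ b, ∑ d, (θ x b i * θ x d j) • ∑ c, C c b d • L c)
          - (η x i • ∑ c, (h * θ x) c j • L c - η x j • ∑ c, (h * θ x) c i • L c) := by
      rw [← Finset.sum_sub_distrib]
      simp only [← sub_smul, hdθ x hx]
      simp only [sub_smul, neg_smul, Finset.sum_smul, Finset.sum_sub_distrib,
        Finset.sum_neg_distrib, Finset.smul_sum, smul_smul]
      congr 2
      rw [Finset.sum_comm]
      refine Finset.sum_congr rfl fun b _ => ?_
      rw [Finset.sum_comm]
      exact Finset.sum_congr rfl fun d _ => Finset.sum_congr rfl fun c _ => by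
        congr 1
        ring
    have h2 : partialDeriv i (fun y => η y j) x • h - partialDeriv j (fun y => η y i) x • h
        = -∑ b, ∑ d, (θ x b i * θ x d j) • κ b d • h := by
      rw [← sub_smul, hdη x hx]
      simp only [neg_smul, Finset.sum_smul, smul_smul]
      exact congrArg _ (Finset.sum_congr rfl fun b _ => Finset.sum_congr rfl fun d _ => by
        congr 1
        ring)
    have h3 : (∑ a, θ x a i • L a) * (∑ a, θ x a j • L a)
        - (∑ a, θ x a j • L a) * (∑ a, θ x a i • L a)
        = ∑ b, ∑ d, (θ x b i * θ x d j) • (L b * L d - L d * L b) := by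
      rw [Finset.sum_mul_sum, Finset.sum_mul_sum,
        Finset.sum_comm (f := fun a b => θ x a j • L a * θ x b i • L b)]
      simp only [← Finset.sum_sub_distrib, Matrix.smul_mul, Matrix.mul_smul, smul_smul, smul_sub]
      exact Finset.sum_congr rfl fun b _ => Finset.sum_congr rfl fun d _ => by
        rw [mul_comm (θ x d j)]
    have h4 : ∑ b, θ x b i • ∑ d, θ x d j • Φ b d
        = ∑ b, ∑ d, (θ x b i * θ x d j) • (L b * L d - L d * L b)
          - ∑ b, ∑ d, (θ x b i * θ x d j) • ∑ c, C c b d • L c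
          - ∑ b, ∑ d, (θ x b i * θ x d j) • κ b d • h := by
      have h5 : ∀ b, θ x b i • ∑ d, θ x d j • Φ b d
          = ∑ d, (θ x b i * θ x d j) • Φ b d := fun b => by
        rw [Finset.smul_sum]
        exact Finset.sum_congr rfl fun d _ => smul_smul _ _ _
      simp only [h5]
      simp only [hΦ, smul_sub, Finset.sum_sub_distrib]
    rw [hdA, hdA, h4, ← h3]
    have h5 := hcomm i
    have h6 := hcomm j
    rw [← h5, ← h6] at h1
    simp only [hAdef]
    rw [add_sub_add_comm, h1, h2]
    simp only [Matrix.add_mul, Matrix.mul_add, Matrix.smul_mul, Matrix.mul_smul, smul_sub,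
      smul_add]
    rw [smul_comm (η x j) (η x i)]
    abel
  have hR : ∀ i, matDeriv (Pi.single i 1) (christoffelMatrix g j) x
      - matDeriv (Pi.single j 1) (christoffelMatrix g i) x
      + (christoffelMatrix g i x * christoffelMatrix g j x
        - christoffelMatrix g j x * christoffelMatrix g i x)
      = ∑ b, θ x b i • ((θ x)⁻¹ * (∑ d, θ x d j • Φ b d) * θ x) := fun i => by
    have h1 := congrArg ((θ x)⁻¹ * ·) (coframe_mul_curvature hU hθ hdet hA hG hx i j)
    simp only [Matrix.nonsing_inv_mul_cancel_left _ _ (hdet x hx).isUnit] at h1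
    rw [h1, hF]
    simp only [Matrix.mul_sum (s := Finset.univ) (f := fun b => θ x b i • _), Matrix.sum_mul,
      Matrix.mul_smul, Matrix.smul_mul, Matrix.mul_assoc]
  rw [ricci_eq_sum_christoffelMatrix]
  simp only [hR, Matrix.sum_apply, Matrix.smul_apply, smul_eq_mul]
  -- Summing over the coordinate index pairs `θ` with `θ⁻¹`, which turns the coordinate trace into
  -- the frame trace in `hρ`.
  rw [Finset.sum_comm]
  simp only [← Matrix.mul_apply, Matrix.mul_assoc]
  simp only [Matrix.mul_nonsing_inv_cancel_left _ _ (hdet x hx).isUnit]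
  rw [Matrix.mul_apply]
  simp only [Matrix.mul_apply (M := ρ), ← hρ, Matrix.transpose_apply, Matrix.sum_mul,
    Matrix.sum_apply, Matrix.smul_mul, Matrix.smul_apply, smul_eq_mul]
  rw [Finset.sum_comm]
  refine Finset.sum_congr rfl fun d _ => ?_
  rw [← Finset.mul_sum]
  congr 1
  simp only [Matrix.mul_apply (N := θ x), Finset.sum_mul]
  rw [Finset.sum_comm]

end MovingFrames

end AloffWallach

namespace AloffWallach

open Filter Topology Matrix

/-! ### Structure constants and the invariant connection -/

section HomogeneousAlgebra

/-- The structure constants `⟪[e_b, e_c], e_a⟫` of the orthonormal frame of `𝔥^⊥`, where the first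
frame vector acts on the three planes by the weights `α`. -/
def structureConst (α : Fin 3 → ℝ) : Fin 7 → Matrix (Fin 7) (Fin 7) ℝ :=
  ![!![0, 0, 0, 0, 0, 0, 0;
        0, 0, α 0, 0, 0, 0, 0;
        0, -α 0, 0, 0, 0, 0, 0;
        0, 0, 0, 0, α 1, 0, 0;
        0, 0, 0, -α 1, 0, 0, 0;
        0, 0, 0, 0, 0, 0, α 2;
        0, 0, 0, 0, 0, -α 2, 0],
    !![0, 0, -α 0, 0, 0, 0, 0;
        0, 0, 0, 0, 0, 0, 0;
        α 0, 0, 0, 0, 0, 0, 0;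
        0, 0, 0, 0, 0, 1, 0;
        0, 0, 0, 0, 0, 0, 1;
        0, 0, 0, -1, 0, 0, 0;
        0, 0, 0, 0, -1, 0, 0],
    !![0, α 0, 0, 0, 0, 0, 0;
        -α 0, 0, 0, 0, 0, 0, 0;
        0, 0, 0, 0, 0, 0, 0;
        0, 0, 0, 0, 0, 0, -1;
        0, 0, 0, 0, 0, 1, 0;
        0, 0, 0, 0, -1, 0, 0;
        0, 0, 0, 1, 0, 0, 0],
    !![0, 0, 0, 0, -α 1, 0, 0;
        0, 0, 0, 0, 0, -1, 0;
        0, 0, 0, 0, 0, 0, 1;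
        0, 0, 0, 0, 0, 0, 0;
        α 1, 0, 0, 0, 0, 0, 0;
        0, 1, 0, 0, 0, 0, 0;
        0, 0, -1, 0, 0, 0, 0],
    !![0, 0, 0, α 1, 0, 0, 0;
        0, 0, 0, 0, 0, 0, -1;
        0, 0, 0, 0, 0, -1, 0;
        -α 1, 0, 0, 0, 0, 0, 0;
        0, 0, 0, 0, 0, 0, 0;
        0, 0, 1, 0, 0, 0, 0;
        0, 1, 0, 0, 0, 0, 0],
    !![0, 0, 0, 0, 0, 0, -α 2;
        0, 0, 0, 1, 0, 0, 0;
        0, 0, 0, 0, 1, 0, 0;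
        0, -1, 0, 0, 0, 0, 0;
        0, 0, -1, 0, 0, 0, 0;
        0, 0, 0, 0, 0, 0, 0;
        α 2, 0, 0, 0, 0, 0, 0],
    !![0, 0, 0, 0, 0, α 2, 0;
        0, 0, 0, 0, 1, 0, 0;
        0, 0, 0, -1, 0, 0, 0;
        0, 0, 1, 0, 0, 0, 0;
        0, -1, 0, 0, 0, 0, 0;
        -α 2, 0, 0, 0, 0, 0, 0;
        0, 0, 0, 0, 0, 0, 0]]

/-- The infinitesimal rotation of the three planes of `𝔥^⊥` with weights `β`. -/
def rotation (β : Fin 3 → ℝ) : Matrix (Fin 7) (Fin 7) ℝ :=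
  !![0, 0, 0, 0, 0, 0, 0;
        0, 0, -β 0, 0, 0, 0, 0;
        0, β 0, 0, 0, 0, 0, 0;
        0, 0, 0, 0, -β 1, 0, 0;
        0, 0, 0, β 1, 0, 0, 0;
        0, 0, 0, 0, 0, 0, -β 2;
        0, 0, 0, 0, 0, β 2, 0]

/-- The vector `(c₀, c₁, c₁, c₂, c₂, c₃, c₃)`. -/
def frameWeights (c : Fin 4 → ℝ) : Fin 7 → ℝ := ![c 0, c 1, c 1, c 2, c 2, c 3, c 3]

/-- The Levi-Civita connection of the diagonal metric with weights `D`, in the orthonormal frame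
of the normal metric. -/
noncomputable def connectionMatrix (α : Fin 3 → ℝ) (D : Fin 7 → ℝ) (b : Fin 7) :
    Matrix (Fin 7) (Fin 7) ℝ :=
  Matrix.of fun a c => structureConst α a b c * (D a + D c - D b) / (2 * D a)

/-- A lookup table for `simp`, used in the finite case checks on indices. -/
theorem structureConst_rows (α : Fin 3 → ℝ) :
    structureConst α 0 0 = ![0, 0, 0, 0, 0, 0, 0] ∧
    structureConst α 0 1 = ![0, 0, α 0, 0, 0, 0, 0] ∧
    structureConst α 0 2 = ![0, -α 0, 0, 0, 0, 0, 0] ∧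
    structureConst α 0 3 = ![0, 0, 0, 0, α 1, 0, 0] ∧
    structureConst α 0 4 = ![0, 0, 0, -α 1, 0, 0, 0] ∧
    structureConst α 0 5 = ![0, 0, 0, 0, 0, 0, α 2] ∧
    structureConst α 0 6 = ![0, 0, 0, 0, 0, -α 2, 0] ∧
    structureConst α 1 0 = ![0, 0, -α 0, 0, 0, 0, 0] ∧
    structureConst α 1 1 = ![0, 0, 0, 0, 0, 0, 0] ∧
    structureConst α 1 2 = ![α 0, 0, 0, 0, 0, 0, 0] ∧
    structureConst α 1 3 = ![0, 0, 0, 0, 0, 1, 0] ∧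
    structureConst α 1 4 = ![0, 0, 0, 0, 0, 0, 1] ∧
    structureConst α 1 5 = ![0, 0, 0, -1, 0, 0, 0] ∧
    structureConst α 1 6 = ![0, 0, 0, 0, -1, 0, 0] ∧
    structureConst α 2 0 = ![0, α 0, 0, 0, 0, 0, 0] ∧
    structureConst α 2 1 = ![-α 0, 0, 0, 0, 0, 0, 0] ∧
    structureConst α 2 2 = ![0, 0, 0, 0, 0, 0, 0] ∧
    structureConst α 2 3 = ![0, 0, 0, 0, 0, 0, -1] ∧
    structureConst α 2 4 = ![0, 0, 0, 0, 0, 1, 0] ∧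
    structureConst α 2 5 = ![0, 0, 0, 0, -1, 0, 0] ∧
    structureConst α 2 6 = ![0, 0, 0, 1, 0, 0, 0] ∧
    structureConst α 3 0 = ![0, 0, 0, 0, -α 1, 0, 0] ∧
    structureConst α 3 1 = ![0, 0, 0, 0, 0, -1, 0] ∧
    structureConst α 3 2 = ![0, 0, 0, 0, 0, 0, 1] ∧
    structureConst α 3 3 = ![0, 0, 0, 0, 0, 0, 0] ∧
    structureConst α 3 4 = ![α 1, 0, 0, 0, 0, 0, 0] ∧
    structureConst α 3 5 = ![0, 1, 0, 0, 0, 0, 0] ∧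
    structureConst α 3 6 = ![0, 0, -1, 0, 0, 0, 0] ∧
    structureConst α 4 0 = ![0, 0, 0, α 1, 0, 0, 0] ∧
    structureConst α 4 1 = ![0, 0, 0, 0, 0, 0, -1] ∧
    structureConst α 4 2 = ![0, 0, 0, 0, 0, -1, 0] ∧
    structureConst α 4 3 = ![-α 1, 0, 0, 0, 0, 0, 0] ∧
    structureConst α 4 4 = ![0, 0, 0, 0, 0, 0, 0] ∧
    structureConst α 4 5 = ![0, 0, 1, 0, 0, 0, 0] ∧
    structureConst α 4 6 = ![0, 1, 0, 0, 0, 0, 0] ∧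
    structureConst α 5 0 = ![0, 0, 0, 0, 0, 0, -α 2] ∧
    structureConst α 5 1 = ![0, 0, 0, 1, 0, 0, 0] ∧
    structureConst α 5 2 = ![0, 0, 0, 0, 1, 0, 0] ∧
    structureConst α 5 3 = ![0, -1, 0, 0, 0, 0, 0] ∧
    structureConst α 5 4 = ![0, 0, -1, 0, 0, 0, 0] ∧
    structureConst α 5 5 = ![0, 0, 0, 0, 0, 0, 0] ∧
    structureConst α 5 6 = ![α 2, 0, 0, 0, 0, 0, 0] ∧
    structureConst α 6 0 = ![0, 0, 0, 0, 0, α 2, 0] ∧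
    structureConst α 6 1 = ![0, 0, 0, 0, 1, 0, 0] ∧
    structureConst α 6 2 = ![0, 0, 0, -1, 0, 0, 0] ∧
    structureConst α 6 3 = ![0, 0, 1, 0, 0, 0, 0] ∧
    structureConst α 6 4 = ![0, -1, 0, 0, 0, 0, 0] ∧
    structureConst α 6 5 = ![-α 2, 0, 0, 0, 0, 0, 0] ∧
    structureConst α 6 6 = ![0, 0, 0, 0, 0, 0, 0] := by
  refine ⟨?_, ?_, ?_, ?_, ?_, ?_, ?_, ?_, ?_, ?_, ?_, ?_, ?_, ?_, ?_, ?_, ?_, ?_, ?_, ?_, ?_, ?_,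
    ?_, ?_, ?_, ?_, ?_, ?_, ?_, ?_, ?_, ?_, ?_, ?_, ?_, ?_, ?_, ?_, ?_, ?_, ?_, ?_, ?_, ?_, ?_, ?_,
    ?_, ?_, ?_⟩ <;> rfl

/-- Antisymmetry of the bracket. With `structureConst_swap_left`, which reflects the invariance of
the inner product, it gives total antisymmetry. -/
theorem structureConst_swap_right (α : Fin 3 → ℝ) (a b c : Fin 7) :
    structureConst α a b c = -structureConst α a c b := by
  fin_cases a <;> fin_cases b <;> fin_cases c <;> simp [structureConst_rows]

theorem structureConst_swap_left (α : Fin 3 → ℝ) (a b c : Fin 7) :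
    structureConst α a b c = -structureConst α b a c := by
  fin_cases a <;> fin_cases b <;> fin_cases c <;> simp [structureConst_rows]

/-- The nonzero terms of a contraction with the structure constants. -/
theorem sum_structureConst_mul (α : Fin 3 → ℝ) (F : Fin 7 → Fin 7 → ℝ) (a : Fin 7) :
    ∑ b, ∑ c, structureConst α a b c * F b c =
      ![α 0 * (F 1 2 - F 2 1) + α 1 * (F 3 4 - F 4 3) + α 2 * (F 5 6 - F 6 5),
        -α 0 * (F 0 2 - F 2 0) + (F 3 5 - F 5 3) + (F 4 6 - F 6 4),
        α 0 * (F 0 1 - F 1 0) - (F 3 6 - F 6 3) + (F 4 5 - F 5 4),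
        -α 1 * (F 0 4 - F 4 0) - (F 1 5 - F 5 1) + (F 2 6 - F 6 2),
        α 1 * (F 0 3 - F 3 0) - (F 1 6 - F 6 1) - (F 2 5 - F 5 2),
        -α 2 * (F 0 6 - F 6 0) + (F 1 3 - F 3 1) + (F 2 4 - F 4 2),
        α 2 * (F 0 5 - F 5 0) + (F 1 4 - F 4 1) - (F 2 3 - F 3 2)] a := by
  fin_cases a <;> simp [structureConst_rows, Fin.sum_univ_seven] <;> ring

theorem sum_rotation_mul (β : Fin 3 → ℝ) (f : Fin 7 → ℝ) (a : Fin 7) :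
    ∑ b, rotation β a b * f b =
      ![0, -β 0 * f 2, β 0 * f 1, -β 1 * f 4, β 1 * f 3, -β 2 * f 6, β 2 * f 5] a := by
  fin_cases a <;> simp [rotation, Fin.sum_univ_seven]

theorem rotation_swap (β : Fin 3 → ℝ) (a b : Fin 7) : rotation β a b = -rotation β b a := by
  fin_cases a <;> fin_cases b <;> simp [rotation]

theorem rotation_mul_frameWeights (β : Fin 3 → ℝ) (w : Fin 4 → ℝ) (a b : Fin 7) :
    rotation β a b * frameWeights w b = frameWeights w a * rotation β a b := by
  fin_cases a <;> fin_cases b <;> simp [rotation, frameWeights, mul_comm]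

set_option maxHeartbeats 2000000 in
/-- The structure constants are invariant under the isotropy rotation. -/
theorem rotation_structureConst (α : Fin 3 → ℝ) {β : Fin 3 → ℝ} (hβ : β 1 = β 0 + β 2)
    (a b c : Fin 7) :
    ∑ e, rotation β a e * structureConst α e b c + ∑ e, rotation β b e * structureConst α a e c
      + ∑ e, rotation β c e * structureConst α a b e = 0 := by
  simp only [sum_rotation_mul]
  fin_cases a <;> fin_cases b <;> fin_cases c <;> simp [structureConst_rows, hβ] <;> ring

theorem frameWeights_ne_zero {w : Fin 4 → ℝ} (hw : ∀ a, w a ≠ 0) (a : Fin 7) :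
    frameWeights w a ≠ 0 := by
  fin_cases a <;> exact hw _

theorem connectionMatrix_torsion (α : Fin 3 → ℝ) {D : Fin 7 → ℝ} (hD : ∀ a, D a ≠ 0)
    (a b c : Fin 7) :
    connectionMatrix α D b a c - connectionMatrix α D c a b = structureConst α a b c := by
  have := hD a
  simp only [connectionMatrix, Matrix.of_apply, structureConst_swap_right α a c b]
  field_simp
  ring

/-- After multiplication by `D a` the weight factor is symmetric in `a` and `c`, while the structure
constant is antisymmetric. -/
theorem connectionMatrix_metric (α : Fin 3 → ℝ) {D : Fin 7 → ℝ} (hD : ∀ a, D a ≠ 0)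
    (b : Fin 7) : (connectionMatrix α D b)ᵀ * diagonal D
      = -(diagonal D * connectionMatrix α D b) := by
  ext a c
  have h1 := hD a
  have h2 := hD c
  have h3 : structureConst α c b a = -structureConst α a b c := by
    rw [structureConst_swap_right, structureConst_swap_left, structureConst_swap_right, neg_neg]
  simp only [Matrix.mul_diagonal, Matrix.neg_apply, Matrix.diagonal_mul, Matrix.transpose_apply,
    connectionMatrix, Matrix.of_apply, h3]
  field_simp
  ring

theorem rotation_metric (β : Fin 3 → ℝ) (w : Fin 4 → ℝ) :
    (rotation β)ᵀ * diagonal (frameWeights w) = -(diagonal (frameWeights w) * rotation β) := by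
  ext a c
  rw [Matrix.mul_diagonal, Matrix.neg_apply, Matrix.diagonal_mul, Matrix.transpose_apply,
    rotation_swap, neg_mul, rotation_mul_frameWeights]

/-- The rotation only mixes indices within one plane, where the weights agree. So all three sums
carry the same factor `(D a + D d - D b) / (2 D a)`, and what remains is the invariance of the
structure constants. -/
theorem rotation_commutator_connectionMatrix (α : Fin 3 → ℝ) {β : Fin 3 → ℝ}
    (hβ : β 1 = β 0 + β 2) {w : Fin 4 → ℝ} (hw : ∀ a, w a ≠ 0) (b : Fin 7) :
    rotation β * connectionMatrix α (frameWeights w) b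
        - connectionMatrix α (frameWeights w) b * rotation β
      = ∑ c, rotation β c b • connectionMatrix α (frameWeights w) c := by
  ext a d
  set D := frameWeights w with hD
  have hD0 : ∀ a, D a ≠ 0 := frameWeights_ne_zero hw
  have hrot : ∀ a e, rotation β a e * D e = D a * rotation β a e :=
    rotation_mul_frameWeights β w
  have hswap : ∀ a e, rotation β a e = -rotation β e a := rotation_swap β
  have hinv := rotation_structureConst α hβ a b d
  have h1 : ∀ e, rotation β a e * connectionMatrix α D b e d
      = rotation β a e * structureConst α e b d * ((D a + D d - D b) / (2 * D a)) := fun e => by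
    by_cases h : rotation β a e = 0
    · simp [h]
    · have : D e = D a := mul_left_cancel₀ h (by rw [hrot, mul_comm])
      simp only [connectionMatrix, Matrix.of_apply, this]
      ring
  have h2 : ∀ e, connectionMatrix α D b a e * rotation β e d
      = -(rotation β d e * structureConst α a b e * ((D a + D d - D b) / (2 * D a))) := fun e => by
    rw [hswap e d]
    by_cases h : rotation β d e = 0
    · simp [h]
    · have : D e = D d := mul_left_cancel₀ h (by rw [hrot, mul_comm])
      simp only [connectionMatrix, Matrix.of_apply, this]
      ring
  have h3 : ∀ e, rotation β e b * connectionMatrix α D e a d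
      = -(rotation β b e * structureConst α a e d * ((D a + D d - D b) / (2 * D a))) := fun e => by
    rw [hswap e b]
    by_cases h : rotation β b e = 0
    · simp [h]
    · have : D e = D b := mul_left_cancel₀ h (by rw [hrot, mul_comm])
      simp only [connectionMatrix, Matrix.of_apply, this]
      ring
  simp only [Matrix.sub_apply, Matrix.mul_apply, Matrix.sum_apply, Matrix.smul_apply, smul_eq_mul,
    h1, h2, h3, Finset.sum_neg_distrib, ← Finset.sum_mul]
  linear_combination ((D a + D d - D b) / (2 * D a)) * hinv

/-- The Ricci eigenvalues of a diagonal metric with weights `w`. -/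
noncomputable def ricciEigenvalue (α : Fin 3 → ℝ) (w : Fin 4 → ℝ) : Fin 4 → ℝ :=
  ![w 0 / 2 * (α 0 ^ 2 / w 1 ^ 2 + α 1 ^ 2 / w 2 ^ 2 + α 2 ^ 2 / w 3 ^ 2),
    6 / w 1 - α 0 ^ 2 * w 0 / (2 * w 1 ^ 2)
      + (w 1 / (w 2 * w 3) - w 2 / (w 1 * w 3) - w 3 / (w 1 * w 2)),
    6 / w 2 - α 1 ^ 2 * w 0 / (2 * w 2 ^ 2)
      + (w 2 / (w 1 * w 3) - w 1 / (w 2 * w 3) - w 3 / (w 1 * w 2)),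
    6 / w 3 - α 2 ^ 2 * w 0 / (2 * w 3 ^ 2)
      + (w 3 / (w 1 * w 2) - w 1 / (w 2 * w 3) - w 2 / (w 1 * w 3))]

/-- The product `L_a L_d` contributes nothing to the trace, since `C a a c = 0`. Antisymmetry gives
the two remaining quadratic terms the common factor `C d a c * C c a b`. -/
theorem sum_curvature (α β : Fin 3 → ℝ) (γ : ℝ) {D : Fin 7 → ℝ} (hD : ∀ a, D a ≠ 0)
    (d b : Fin 7) :
    ∑ a, (connectionMatrix α D a * connectionMatrix α D d
        - connectionMatrix α D d * connectionMatrix α D a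
        - ∑ c, structureConst α c a d • connectionMatrix α D c
        - (γ * rotation β d a) • rotation β) a b
      = ∑ a, ∑ c, structureConst α d a c * (structureConst α c a b
          * (((D a + D c - D d) * (D c + D b - D a) / (2 * D c) - (D a + D b - D c)) / (2 * D a)))
        - γ * ∑ a, rotation β d a * rotation β a b := by
  simp only [Finset.mul_sum, ← Finset.sum_sub_distrib]
  refine Finset.sum_congr rfl fun a _ => ?_
  simp only [Matrix.sub_apply, Matrix.mul_apply, Matrix.sum_apply, Matrix.smul_apply, smul_eq_mul,
    mul_assoc, ← Finset.sum_sub_distrib]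
  congr 1
  refine Finset.sum_congr rfl fun c _ => ?_
  have h1 : structureConst α a a c = 0 := by
    have := structureConst_swap_left α a a c
    linarith
  have h2 : structureConst α a d c = -structureConst α d a c := structureConst_swap_left α a d c
  have h3 : structureConst α c a d = -structureConst α d a c := by
    rw [structureConst_swap_right, structureConst_swap_left, structureConst_swap_right, neg_neg]
  have h4 : structureConst α a c b = -structureConst α c a b := structureConst_swap_left α a c b
  have h5 := hD a
  have h6 := hD c
  simp only [connectionMatrix, Matrix.of_apply, h1, h2, h3, h4]
  field_simp
  ring

end HomogeneousAlgebra

end AloffWallach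

/-! ### Evaluation of the Ricci contraction -/

namespace AloffWallach

open Filter Topology Matrix

/-- Each bracket of two frame vectors has at most one nonzero component in `𝔥^⊥`, so every summand
is zero, whatever the weights `G`. -/
theorem sum_structureConst_mul_structureConst_of_ne (α : Fin 3 → ℝ) (G : Fin 7 → Fin 7 → ℝ)
    {d b : Fin 7} (hdb : d ≠ b) :
    ∑ a, ∑ c, structureConst α d a c * (structureConst α c a b * G a c) = 0 := by
  rw [sum_structureConst_mul]
  fin_cases d <;> fin_cases b <;> first | exact absurd rfl hdb | simp [structureConst_rows]

theorem sum_rotation_mul_rotation_of_ne (β : Fin 3 → ℝ) {d b : Fin 7} (hdb : d ≠ b) :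
    ∑ a, rotation β d a * rotation β a b = 0 := by
  rw [sum_rotation_mul]
  fin_cases d <;> fin_cases b <;> first | exact absurd rfl hdb | simp [rotation]

-- Origin of the `6` on the three planes: `𝔭₀` contributes `α²` besides its term in `w 0`, the
-- isotropy contributes `γ β² = 4 - α²`, and the brackets between the other two planes contribute
-- `2` besides the terms in `w 1`, `w 2`, `w 3`.
set_option maxHeartbeats 2000000 in
theorem sum_curvature_eq_ricciEigenvalue {α β : Fin 3 → ℝ} {γ : ℝ}
    (hαβ : ∀ m, γ * β m ^ 2 = 4 - α m ^ 2) {w : Fin 4 → ℝ} (hw : ∀ a, w a ≠ 0) (d b : Fin 7) :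
    ∑ a, ∑ c, structureConst α d a c * (structureConst α c a b
          * (((frameWeights w a + frameWeights w c - frameWeights w d)
            * (frameWeights w c + frameWeights w b - frameWeights w a) / (2 * frameWeights w c)
            - (frameWeights w a + frameWeights w b - frameWeights w c)) / (2 * frameWeights w a)))
        - γ * ∑ a, rotation β d a * rotation β a b
      = diagonal (frameWeights fun a => w a * ricciEigenvalue α w a) d b := by
  have h0 := hw 0
  have h1 := hw 1
  have h2 := hw 2
  have h3 := hw 3
  have e0 := hαβ 0
  have e1 := hαβ 1
  have e2 := hαβ 2
  by_cases hdb : d = b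
  · subst hdb
    rw [Matrix.diagonal_apply_eq, sum_structureConst_mul, sum_rotation_mul]
    have E0 : γ * (β 0 * β 0) = 4 - α 0 ^ 2 := by rw [← e0]; ring
    have E1 : γ * (β 1 * β 1) = 4 - α 1 ^ 2 := by rw [← e1]; ring
    have E2 : γ * (β 2 * β 2) = 4 - α 2 ^ 2 := by rw [← e2]; ring
    fin_cases d <;> simp [structureConst_rows, rotation, frameWeights, ricciEigenvalue, E0, E1, E2]
    all_goals
      field_simp
      ring
  · rw [Matrix.diagonal_apply_ne _ hdb, sum_structureConst_mul_structureConst_of_ne _ _ hdb,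
      sum_rotation_mul_rotation_of_ne _ hdb, mul_zero, sub_zero]

end AloffWallach

namespace AloffWallach

open Filter Topology Matrix

/-! ### The frame and brackets of `𝔰𝔲(3)` -/

section LieAlgebra

theorem ip_add_left (X Y Z : Mat3) : ip (X + Y) Z = ip X Z + ip Y Z := by
  simp only [ip, Matrix.add_mul, Matrix.trace_add, Complex.add_re]
  ring

theorem ip_smul_left (c : ℝ) (X Y : Mat3) : ip (c • X) Y = c * ip X Y := by
  simp only [ip, Matrix.smul_mul, Matrix.trace_smul, Complex.smul_re, smul_eq_mul]
  ring

theorem ip_comm (X Y : Mat3) : ip X Y = ip Y X := by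
  rw [ip, ip, Matrix.trace_mul_comm]

theorem ip_add_right (X Y Z : Mat3) : ip X (Y + Z) = ip X Y + ip X Z := by
  rw [ip_comm, ip_add_left, ip_comm Y, ip_comm Z]

theorem ip_smul_right (c : ℝ) (X Y : Mat3) : ip X (c • Y) = c * ip X Y := by
  rw [ip_comm, ip_smul_left, ip_comm Y]

/-- Pairing with a fixed matrix as a linear functional. -/
noncomputable def ipLinear (Y : Mat3) : (Fin 3 → Fin 3 → ℂ) →ₗ[ℝ] ℝ where
  toFun X := ip X Y
  map_add' X Z := ip_add_left X Z Y
  map_smul' c X := ip_smul_left c X Y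

/-- The generator `diag (-(k₁ + k₂) i, k₁ i, k₂ i)` of the isotropy algebra. -/
noncomputable def isotropyGen (k₁ k₂ : ℕ) : Mat3 :=
  Matrix.diagonal fun a => (kvec k₁ k₂ a : ℂ) * Complex.I

/-- An orthonormal frame of `𝔥^⊥`. -/
noncomputable def frame (k₁ k₂ : ℕ) : Fin 7 → Mat3 :=
  ![matT k₁ k₂, matE 1 2, matF 1 2, matE 0 2, matF 0 2, matE 0 1, matF 0 1]

/-- The weights of the adjoint action of the unit vector of `𝔭₀` on `𝔭₁`, `𝔭₂`, `𝔭₃`. -/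
noncomputable def frameRoot (k₁ k₂ : ℕ) : Fin 3 → ℝ :=
  ![1 / Real.sqrt (3 * Gam k₁ k₂) * (3 * (k₁ + k₂)), 1 / Real.sqrt (3 * Gam k₁ k₂) * (3 * k₁),
    -(1 / Real.sqrt (3 * Gam k₁ k₂) * (3 * k₂))]

/-- The weights of the isotropy action on `𝔭₁`, `𝔭₂`, `𝔭₃`. -/
def isotropyRoot (k₁ k₂ : ℕ) : Fin 3 → ℝ := ![(k₁ : ℝ) - k₂, -(k₁ + 2 * k₂), -(2 * k₁ + k₂)]

theorem isotropyRoot_add (k₁ k₂ : ℕ) :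
    isotropyRoot k₁ k₂ 1 = isotropyRoot k₁ k₂ 0 + isotropyRoot k₁ k₂ 2 := by
  simp [isotropyRoot]
  ring

theorem Gam_pos {k₁ k₂ : ℕ} (hgcd : Nat.gcd k₁ k₂ = 1) : 0 < Gam k₁ k₂ := by
  have h : 0 < k₁ ∨ 0 < k₂ := by
    by_contra! h
    simp [Nat.le_zero.1 h.1, Nat.le_zero.1 h.2] at hgcd
  unfold Gam
  rcases h with h | h
  · have : (0 : ℝ) < k₁ := by exact_mod_cast h
    positivity
  · have : (0 : ℝ) < k₂ := by exact_mod_cast h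
    positivity

theorem inv_sqrt_sq {k₁ k₂ : ℕ} (hΓ : 0 < Gam k₁ k₂) :
    (1 / Real.sqrt (3 * Gam k₁ k₂)) ^ 2 * (3 * Gam k₁ k₂) = 1 := by
  rw [div_pow, Real.sq_sqrt (by positivity)]
  field_simp

/-- The unit vector of `𝔭₀` and the isotropy generator divided by `√Γ` form an orthonormal basis of
the diagonal torus algebra; the squared values of a root on it add up to its squared length `4`. -/
theorem isotropyRoot_sq {k₁ k₂ : ℕ} (hΓ : 0 < Gam k₁ k₂) (m : Fin 3) :
    1 / Gam k₁ k₂ * isotropyRoot k₁ k₂ m ^ 2 = 4 - frameRoot k₁ k₂ m ^ 2 := by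
  have hq := inv_sqrt_sq hΓ
  have hq' : (1 / Real.sqrt (3 * Gam k₁ k₂)) ^ 2 = 1 / (3 * Gam k₁ k₂) := by
    rw [eq_div_iff (by positivity), hq]
  have hne := hΓ.ne'
  fin_cases m <;>
    simp only [isotropyRoot, frameRoot, Fin.zero_eta, Fin.mk_one, Fin.reduceFinMk,
      Matrix.cons_val, mul_pow, neg_sq, hq'] <;>
    field_simp <;> rw [Gam] <;> ring

/-- Matrix entries of a general skew-Hermitian matrix in terms of its frame coordinates. -/
noncomputable def skewMatrix (k₁ k₂ : ℕ) (x : Fin 7 → ℝ) (v z : ℝ) : Mat3 :=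
  !![(1 / Real.sqrt (3 * Gam k₁ k₂) * x 0 * (k₁ - k₂) - v * (k₁ + k₂) + z : ℝ) * Complex.I,
      x 5 + x 6 * Complex.I, x 3 + x 4 * Complex.I;
    -x 5 + x 6 * Complex.I,
      (1 / Real.sqrt (3 * Gam k₁ k₂) * x 0 * (2 * k₂ + k₁) + v * k₁ + z : ℝ) * Complex.I,
      x 1 + x 2 * Complex.I;
    -x 3 + x 4 * Complex.I, -x 1 + x 2 * Complex.I,
      (-(1 / Real.sqrt (3 * Gam k₁ k₂)) * x 0 * (2 * k₁ + k₂) + v * k₂ + z : ℝ) * Complex.I]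

theorem ip_frame (k₁ k₂ : ℕ) (X : Mat3) (a : Fin 7) : ip X (frame k₁ k₂ a) =
    ![1 / 2 * (1 / Real.sqrt (3 * Gam k₁ k₂)) * ((k₁ - k₂) * (X 0 0).im
        + (2 * k₂ + k₁) * (X 1 1).im - (2 * k₁ + k₂) * (X 2 2).im),
      1 / 2 * ((X 1 2).re - (X 2 1).re), 1 / 2 * ((X 1 2).im + (X 2 1).im),
      1 / 2 * ((X 0 2).re - (X 2 0).re), 1 / 2 * ((X 0 2).im + (X 2 0).im),
      1 / 2 * ((X 0 1).re - (X 1 0).re), 1 / 2 * ((X 0 1).im + (X 1 0).im)] a := by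
  simp only [frame, matT]
  generalize 1 / Real.sqrt (3 * Gam k₁ k₂) = q
  fin_cases a <;>
    simp [ip, matE, matF, Matrix.trace, Matrix.mul_apply, Fin.sum_univ_three,
      Matrix.single_apply, Matrix.diagonal_apply] <;> ring

theorem ip_isotropyGen (k₁ k₂ : ℕ) (X : Mat3) : ip X (isotropyGen k₁ k₂) =
    1 / 2 * (-(k₁ + k₂) * (X 0 0).im + k₁ * (X 1 1).im + k₂ * (X 2 2).im) := by
  simp [ip, isotropyGen, kvec, Matrix.trace, Matrix.mul_apply, Fin.sum_univ_three,
    Matrix.diagonal_apply]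
  ring

/-- The frame, the isotropy generator and the scalar `i` form an orthogonal basis of the
skew-Hermitian matrices. The divisor `Γ` is the squared length of the generator. -/
theorem eq_skewMatrix {k₁ k₂ : ℕ} (hΓ : 0 < Gam k₁ k₂) {X : Mat3} (hX : Xᴴ = -X) :
    X = skewMatrix k₁ k₂ (fun a => ip X (frame k₁ k₂ a))
      (ip X (isotropyGen k₁ k₂) / Gam k₁ k₂) (X.trace.im / 3) := by
  have hq := inv_sqrt_sq hΓ
  have hG : Gam k₁ k₂ = (k₁ : ℝ) ^ 2 + (k₂ : ℝ) ^ 2 + (k₁ : ℝ) * k₂ := rfl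
  have he : ∀ i j, star (X j i) = -X i j := fun i j => congrFun (congrFun hX i) j
  have hre : ∀ i j, (X j i).re = -(X i j).re := fun i j => congrArg Complex.re (he i j)
  have him : ∀ i j, (X j i).im = (X i j).im := fun i j => by
    simpa using congrArg Complex.im (he i j)
  have h0 : ∀ i, (X i i).re = 0 := fun i => by linarith [hre i i]
  have hne := hΓ.ne'
  have hq' : (1 / Real.sqrt (3 * Gam k₁ k₂)) ^ 2 = 1 / (3 * Gam k₁ k₂) := by
    rw [eq_div_iff (by positivity), hq]
  simp only [skewMatrix, ip_frame, ip_isotropyGen, Matrix.trace, Fin.sum_univ_three,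
    Matrix.diag_apply, Complex.add_im, Matrix.cons_val]
  generalize 1 / Real.sqrt (3 * Gam k₁ k₂) = q at hq'
  ext i j
  fin_cases i <;> fin_cases j <;> apply Complex.ext <;>
    simp [h0, hre 0 1, hre 0 2, hre 1 2, him 0 1, him 0 2, him 1 2]
  all_goals try ring1
  all_goals
    ring_nf
    rw [hq']
    field_simp
    rw [hG]
    ring

/-- This justifies the tables `structureConst` and `rotation` as brackets of actual matrices. The
scalar parts `z`, `z'` are central and drop out, so the trace need not be known here. -/
theorem ip_bracket_skewMatrix_frame (k₁ k₂ : ℕ) (x y : Fin 7 → ℝ) (v z w z' : ℝ) (a : Fin 7) :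
    ip (skewMatrix k₁ k₂ x v z * skewMatrix k₁ k₂ y w z'
        - skewMatrix k₁ k₂ y w z' * skewMatrix k₁ k₂ x v z) (frame k₁ k₂ a)
      = ∑ b, ∑ d, structureConst (frameRoot k₁ k₂) a b d * (x b * y d)
        + (v * ∑ c, rotation (isotropyRoot k₁ k₂) a c * y c
          - w * ∑ c, rotation (isotropyRoot k₁ k₂) a c * x c) := by
  rw [sum_structureConst_mul, sum_rotation_mul, sum_rotation_mul, ip_frame]
  simp only [skewMatrix, frameRoot, isotropyRoot]
  generalize 1 / Real.sqrt (3 * Gam k₁ k₂) = q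
  fin_cases a <;> simp <;> ring

theorem ip_bracket_skewMatrix_isotropyGen (k₁ k₂ : ℕ) (x y : Fin 7 → ℝ) (v z w z' : ℝ) :
    ip (skewMatrix k₁ k₂ x v z * skewMatrix k₁ k₂ y w z'
        - skewMatrix k₁ k₂ y w z' * skewMatrix k₁ k₂ x v z) (isotropyGen k₁ k₂)
      = ∑ b, ∑ d, rotation (isotropyRoot k₁ k₂) d b * (x b * y d) := by
  rw [ip_isotropyGen, Finset.sum_comm]
  simp only [sum_rotation_mul]
  simp only [skewMatrix, isotropyRoot]
  generalize 1 / Real.sqrt (3 * Gam k₁ k₂) = q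
  simp [Fin.sum_univ_seven]
  ring

end LieAlgebra

end AloffWallach

namespace AloffWallach

open Filter Topology Matrix

/-! ### The Maurer-Cartan form and the induced coframe -/

section MaurerCartan

variable {n : ℕ} {φ : (Fin n → ℝ) → SU3} {x : Fin n → ℝ}

theorem maurerCartan_eq (φ : (Fin n → ℝ) → SU3) (x v : Fin n → ℝ) :
    maurerCartan φ x v = ((φ x : SU3) : Mat3)ᴴ * matDeriv v (fun y => ((φ y : SU3) : Mat3)) x :=
  rfl

theorem conjTranspose_mul_self_coe (g : SU3) : ((g : SU3) : Mat3)ᴴ * (g : Mat3) = 1 :=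
  Matrix.mem_unitaryGroup_iff'.1 (Matrix.mem_specialUnitaryGroup_iff.1 g.2).1

theorem self_mul_conjTranspose_coe (g : SU3) : ((g : SU3) : Mat3) * (g : Mat3)ᴴ = 1 :=
  Matrix.mem_unitaryGroup_iff.1 (Matrix.mem_specialUnitaryGroup_iff.1 g.2).1

theorem det_coe (g : SU3) : ((g : SU3) : Mat3).det = 1 :=
  (Matrix.mem_specialUnitaryGroup_iff.1 g.2).2

theorem smoothAt_maurerCartan (hφ : MatSmoothAt (fun y => ((φ y : SU3) : Mat3)) x)
    (v : Fin n → ℝ) : MatSmoothAt (fun y => maurerCartan φ y v) x :=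
  hφ.conjTranspose.mul (hφ.matDeriv v)

theorem maurerCartan_conjTranspose (hφ : MatSmoothAt (fun y => ((φ y : SU3) : Mat3)) x)
    (v : Fin n → ℝ) : (maurerCartan φ x v)ᴴ = -maurerCartan φ x v := by
  have h := matDeriv_mul hφ.conjTranspose hφ v
  simp only [conjTranspose_mul_self_coe, matDeriv_const, matDeriv_conjTranspose hφ] at h
  rw [maurerCartan_eq, Matrix.conjTranspose_mul, Matrix.conjTranspose_conjTranspose]
  exact eq_neg_of_add_eq_zero_left h.symm

/-- Jacobi's formula: the inverse is the adjugate because the determinant is `1`, and the trace of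
the adjugate times `dφ` is the derivative of the constant `det φ`. -/
theorem maurerCartan_trace (hφ : MatSmoothAt (fun y => ((φ y : SU3) : Mat3)) x)
    (v : Fin n → ℝ) : (maurerCartan φ x v).trace = 0 := by
  have hinv : ((φ x : SU3) : Mat3)ᴴ = ((φ x : SU3) : Mat3).adjugate := by
    have h := Matrix.adjugate_mul ((φ x : SU3) : Mat3)
    rw [det_coe, one_smul] at h
    calc ((φ x : SU3) : Mat3)ᴴ
        = ((φ x : SU3) : Mat3).adjugate * (φ x : Mat3) * ((φ x : SU3) : Mat3)ᴴ := by
          rw [h, one_mul]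
      _ = _ := by rw [mul_assoc, self_mul_conjTranspose_coe, mul_one]
  have hd : ∀ a b, HasFDerivAt (fun y => ((φ y : SU3) : Mat3) a b)
      (fderiv ℝ (fun y => ((φ y : SU3) : Mat3) a b) x) x := fun a b =>
    (hφ.differentiableAt a b).hasFDerivAt
  have hdet := (((((((hd 0 0).mul (hd 1 1)).mul (hd 2 2)).sub
    (((hd 0 0).mul (hd 1 2)).mul (hd 2 1))).sub (((hd 0 1).mul (hd 1 0)).mul (hd 2 2))).add
    (((hd 0 1).mul (hd 1 2)).mul (hd 2 0))).add (((hd 0 2).mul (hd 1 0)).mul (hd 2 1))).sub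
    (((hd 0 2).mul (hd 1 1)).mul (hd 2 0))
  have hconst := hdet.congr_of_eventuallyEq (f₁ := fun _ => (1 : ℂ))
    (Eventually.of_forall fun y => by rw [← det_coe (φ y), Matrix.det_fin_three]; rfl)
  have h := DFunLike.congr_fun (hconst.unique (hasFDerivAt_const (1 : ℂ) x)) v
  rw [maurerCartan_eq, hinv, Matrix.adjugate_fin_three]
  simp only [_root_.add_apply, _root_.sub_apply, _root_.smul_apply, smul_eq_mul,
    _root_.zero_apply, Pi.mul_apply] at h
  have hB : ∀ a b, fderiv ℝ (fun y => ((φ y : SU3) : Mat3) a b) x v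
      = matDeriv v (fun y => ((φ y : SU3) : Mat3)) x a b := fun _ _ => rfl
  simp only [hB] at h
  generalize matDeriv v (fun y => ((φ y : SU3) : Mat3)) x = B at h ⊢
  simp only [Matrix.trace, Fin.sum_univ_three, Matrix.diag_apply, Matrix.mul_apply,
    Matrix.of_apply, Matrix.cons_val', Matrix.cons_val]
  linear_combination h

/-- By unitarity `(dφ)ᴴ dφ` is minus a product of two Maurer-Cartan matrices; the second derivatives
of `φ` cancel by symmetry. -/
theorem maurerCartan_structure_equation (hφ : MatSmoothAt (fun y => ((φ y : SU3) : Mat3)) x)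
    (v w : Fin n → ℝ) :
    matDeriv v (fun y => maurerCartan φ y w) x - matDeriv w (fun y => maurerCartan φ y v) x
      = -(maurerCartan φ x v * maurerCartan φ x w - maurerCartan φ x w * maurerCartan φ x v) := by
  have h : ∀ v w, matDeriv v (fun y => maurerCartan φ y w) x
      = -(maurerCartan φ x v * maurerCartan φ x w) + ((φ x : SU3) : Mat3)ᴴ
        * matDeriv v (matDeriv w fun y => ((φ y : SU3) : Mat3)) x := fun v w => by
    rw [show (fun y => maurerCartan φ y w) = fun y => ((φ y : SU3) : Mat3)ᴴ
      * matDeriv w (fun y => ((φ y : SU3) : Mat3)) y from rfl,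
      matDeriv_mul hφ.conjTranspose (hφ.matDeriv w), matDeriv_conjTranspose hφ, ← neg_mul,
      ← maurerCartan_conjTranspose hφ, maurerCartan_eq, maurerCartan_eq,
      Matrix.conjTranspose_mul, Matrix.conjTranspose_conjTranspose, mul_assoc,
      ← mul_assoc (φ x : Mat3),
      self_mul_conjTranspose_coe, one_mul]
  rw [h, h, matDeriv_comm hφ]
  abel

theorem maurerCartan_eq_sum (φ : (Fin n → ℝ) → SU3) (x v : Fin n → ℝ) :
    maurerCartan φ x v = ∑ i, v i • maurerCartan φ x (Pi.single i 1) := by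
  have h : ∀ v, matDeriv v (fun y => ((φ y : SU3) : Mat3)) x
      = ∑ i, v i • matDeriv (Pi.single i 1) (fun y => ((φ y : SU3) : Mat3)) x := fun v => by
    ext a b
    simp only [matDeriv, Matrix.of_apply, Matrix.sum_apply, Matrix.smul_apply, ← map_smul,
      ← map_sum]
    congr 1
    ext j
    simp [Finset.sum_apply, Pi.single_apply]
  simp only [maurerCartan_eq]
  rw [h, Matrix.mul_sum]
  simp only [Matrix.mul_smul]

/-- The matrix of the coframe on `SU(3) / S¹ₖ` induced by a map into `SU(3)`. -/
noncomputable def coframeMatrix (k₁ k₂ : ℕ) (φ : (Fin n → ℝ) → SU3) (x : Fin n → ℝ) :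
    Matrix (Fin 7) (Fin n) ℝ :=
  Matrix.of fun a i => ip (maurerCartan φ x (Pi.single i 1)) (frame k₁ k₂ a)

/-- The isotropy component of the Maurer-Cartan form. -/
noncomputable def isotropyForm (k₁ k₂ : ℕ) (φ : (Fin n → ℝ) → SU3) (x : Fin n → ℝ) (i : Fin n) :
    ℝ :=
  ip (maurerCartan φ x (Pi.single i 1)) (isotropyGen k₁ k₂) / Gam k₁ k₂

theorem ip_frame_frame {k₁ k₂ : ℕ} (hΓ : 0 < Gam k₁ k₂) (a b : Fin 7) :
    ip (frame k₁ k₂ a) (frame k₁ k₂ b) = (1 : Matrix (Fin 7) (Fin 7) ℝ) a b := by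
  have hq := inv_sqrt_sq hΓ
  rw [Gam] at hq
  rw [ip_frame]
  simp only [frame, matT, Gam]
  generalize 1 / Real.sqrt (3 * ((k₁ : ℝ) ^ 2 + (k₂ : ℝ) ^ 2 + (k₁ : ℝ) * k₂)) = q at *
  fin_cases a <;> fin_cases b <;> simp [matE, matF]
  · linear_combination hq
  all_goals norm_num

theorem diagForm_eq {k₁ k₂ : ℕ} (hΓ : 0 < Gam k₁ k₂) (c : Fin 4 → ℝ) (X Y : Mat3) :
    diagForm k₁ k₂ c X Y
      = ∑ a, frameWeights c a * ip X (frame k₁ k₂ a) * ip Y (frame k₁ k₂ a) := by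
  have hT : ip (matT k₁ k₂) (matT k₁ k₂) = 1 :=
    (ip_frame_frame hΓ 0 0).trans (by simp)
  have hEE12 : ip (matE 1 2) (matE 1 2) = 1 :=
    (ip_frame_frame hΓ 1 1).trans (by simp)
  have hFF12 : ip (matF 1 2) (matF 1 2) = 1 :=
    (ip_frame_frame hΓ 2 2).trans (by simp)
  have hEF12 : ip (matE 1 2) (matF 1 2) = 0 :=
    (ip_frame_frame hΓ 1 2).trans (by simp)
  have hEE02 : ip (matE 0 2) (matE 0 2) = 1 :=
    (ip_frame_frame hΓ 3 3).trans (by simp)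
  have hFF02 : ip (matF 0 2) (matF 0 2) = 1 :=
    (ip_frame_frame hΓ 4 4).trans (by simp)
  have hEF02 : ip (matE 0 2) (matF 0 2) = 0 :=
    (ip_frame_frame hΓ 3 4).trans (by simp)
  have hEE01 : ip (matE 0 1) (matE 0 1) = 1 :=
    (ip_frame_frame hΓ 5 5).trans (by simp)
  have hFF01 : ip (matF 0 1) (matF 0 1) = 1 :=
    (ip_frame_frame hΓ 6 6).trans (by simp)
  have hEF01 : ip (matE 0 1) (matF 0 1) = 0 :=
    (ip_frame_frame hΓ 5 6).trans (by simp)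
  simp only [diagForm, Fin.sum_univ_four, Fin.sum_univ_seven, proj, frame, frameWeights,
    Matrix.cons_val, ip_add_left, ip_add_right, ip_smul_left, ip_smul_right, hT,
    hEE12, hFF12, hEF12,
    ip_comm (matF 1 2) (matE 1 2), hEE02, hFF02, hEF02,
    ip_comm (matF 0 2) (matE 0 2), hEE01, hFF01, hEF01,
    ip_comm (matF 0 1) (matE 0 1)]
  ring

theorem coordMatrix_eq {k₁ k₂ : ℕ} (hΓ : 0 < Gam k₁ k₂) (P : LocalParam k₁ k₂) (c : Fin 4 → ℝ)
    (x : Fin 7 → ℝ) : P.coordMatrix c x = (coframeMatrix k₁ k₂ P.lift x)ᵀ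
      * diagonal (frameWeights c) * coframeMatrix k₁ k₂ P.lift x := by
  ext i j
  rw [LocalParam.coordMatrix, Matrix.of_apply, diagForm_eq hΓ, Matrix.mul_apply]
  simp only [Matrix.mul_diagonal, Matrix.transpose_apply, coframeMatrix, Matrix.of_apply]
  exact Finset.sum_congr rfl fun a _ => by ring

theorem coframeMatrix_mulVec (k₁ k₂ : ℕ) (φ : (Fin n → ℝ) → SU3) (x v : Fin n → ℝ) (a : Fin 7) :
    (coframeMatrix k₁ k₂ φ x *ᵥ v) a = ip (maurerCartan φ x v) (frame k₁ k₂ a) := by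
  have h := map_sum (ipLinear (frame k₁ k₂ a)) (fun i => v i • maurerCartan φ x (Pi.single i 1))
    Finset.univ
  rw [← maurerCartan_eq_sum] at h
  refine Eq.trans ?_ h.symm
  simp only [Matrix.mulVec, dotProduct]
  refine Finset.sum_congr rfl fun i _ => ?_
  rw [mul_comm]
  exact (ip_smul_left _ _ _).symm

theorem skewMatrix_zero (k₁ k₂ : ℕ) (v : ℝ) :
    skewMatrix k₁ k₂ 0 v 0 = v • isotropyGen k₁ k₂ := by
  ext i j
  fin_cases i <;> fin_cases j <;> simp [skewMatrix, isotropyGen, kvec] <;> ring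

theorem LocalParam.smoothAt_lift {k₁ k₂ : ℕ} (P : LocalParam k₁ k₂) {x : Fin 7 → ℝ}
    (hx : x ∈ P.source) : MatSmoothAt (fun y => ((P.lift y : SU3) : Mat3)) x := fun a b =>
  (P.smooth a b).contDiffAt (P.isOpen_source.mem_nhds hx)

/-- A kernel vector has Maurer-Cartan image orthogonal to the frame. This image is skew-Hermitian
and traceless, hence lies in `𝔥`, against the immersion condition. -/
theorem det_coframeMatrix_ne_zero {k₁ k₂ : ℕ} (hΓ : 0 < Gam k₁ k₂) (P : LocalParam k₁ k₂)
    {x : Fin 7 → ℝ} (hx : x ∈ P.source) : (coframeMatrix k₁ k₂ P.lift x).det ≠ 0 := by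
  intro h
  obtain ⟨v, hv, hv0⟩ := Matrix.exists_mulVec_eq_zero_iff.2 h
  refine hv (P.immersion x hx v ?_)
  have hs := P.smoothAt_lift hx
  rw [eq_skewMatrix hΓ (maurerCartan_conjTranspose hs v), maurerCartan_trace hs]
  have h0 : (fun a => ip (maurerCartan P.lift x v) (frame k₁ k₂ a)) = 0 := by
    ext a
    rw [← coframeMatrix_mulVec, hv0]
  rw [h0, Complex.zero_im, zero_div, skewMatrix_zero]
  exact Submodule.smul_mem _ _ (Submodule.mem_span_singleton_self _)

/-- The Ricci tensor of a diagonal metric in any local parametrization. -/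
theorem ricci_metric_eq {k₁ k₂ : ℕ} (hΓ : 0 < Gam k₁ k₂) {w : Fin 4 → ℝ} (hw : ∀ a, w a ≠ 0)
    (P : LocalParam k₁ k₂) {x : Fin 7 → ℝ} (hx : x ∈ P.source) (i j : Fin 7) :
    ricci (P.coordMatrix w) i j x
      = P.coordMatrix (fun a => w a * ricciEigenvalue (frameRoot k₁ k₂) w a) x i j := by
  rw [coordMatrix_eq hΓ]
  have hβ := isotropyRoot_add k₁ k₂
  have hD := frameWeights_ne_zero hw
  have hlin : ∀ x ∈ P.source, ∀ Y : Mat3, ∀ i j,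
      partialDeriv i (fun y => ip (maurerCartan P.lift y (Pi.single j 1)) Y) x
        - partialDeriv j (fun y => ip (maurerCartan P.lift y (Pi.single i 1)) Y) x
      = -ip (maurerCartan P.lift x (Pi.single i 1) * maurerCartan P.lift x (Pi.single j 1)
          - maurerCartan P.lift x (Pi.single j 1) * maurerCartan P.lift x (Pi.single i 1)) Y := by
    intro x hx Y i j
    have hs := P.smoothAt_lift hx
    have h : ∀ v w, fderiv ℝ (fun y => ip (maurerCartan P.lift y w) Y) x v
        = ip (matDeriv v (fun y => maurerCartan P.lift y w) x) Y := fun v w =>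
      fderiv_linear_matrix (ipLinear Y) (smoothAt_maurerCartan hs w) v
    have h2 := congrArg (fun X => ip X Y)
      (maurerCartan_structure_equation hs (Pi.single i 1) (Pi.single j 1))
    simp only [partialDeriv, h]
    have h3 := map_sub (ipLinear Y)
      (matDeriv (Pi.single i 1) (fun y => maurerCartan P.lift y (Pi.single j 1)) x)
      (matDeriv (Pi.single j 1) (fun y => maurerCartan P.lift y (Pi.single i 1)) x)
    exact h3.symm.trans (h2.trans (map_neg (ipLinear Y) _))
  have hskew : ∀ x ∈ P.source, ∀ i, maurerCartan P.lift x (Pi.single i 1)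
      = skewMatrix k₁ k₂ (fun a => coframeMatrix k₁ k₂ P.lift x a i)
        (isotropyForm k₁ k₂ P.lift x i)
        ((maurerCartan P.lift x (Pi.single i 1)).trace.im / 3) := fun x hx i =>
    eq_skewMatrix hΓ (maurerCartan_conjTranspose (P.smoothAt_lift hx) _)
  -- By invariance of the inner product, `⟪[X_b, X_d], H⟫` is the `(d, b)` entry of the action of
  -- the isotropy generator `H`; dividing by `⟪H, H⟫ = Γ` gives `κ`.
  refine ricci_eq_of_structure_equations (θ := coframeMatrix k₁ k₂ P.lift)
    (η := isotropyForm k₁ k₂ P.lift) (L := connectionMatrix (frameRoot k₁ k₂) (frameWeights w))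
    (h := rotation (isotropyRoot k₁ k₂)) (C := structureConst (frameRoot k₁ k₂))
    (κ := Matrix.of fun b d => 1 / Gam k₁ k₂ * rotation (isotropyRoot k₁ k₂) d b)
    P.isOpen_source hD ?_ (fun x hx => det_coframeMatrix_ne_zero hΓ P hx) ?_
    (connectionMatrix_metric _ hD) (rotation_metric _ w)
    (connectionMatrix_torsion _ hD) (rotation_commutator_connectionMatrix _ hβ hw) ?_ ?_ ?_
    (fun x _ => coordMatrix_eq hΓ P w x) hx i j
  · exact fun x hx a i => MatSmoothAt.linear (ipLinear _)
      (smoothAt_maurerCartan (P.smoothAt_lift hx) _)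
  · exact fun x hx i => (MatSmoothAt.linear (ipLinear _)
      (smoothAt_maurerCartan (P.smoothAt_lift hx) _)).div_const _
  · intro d b
    rw [← sum_curvature_eq_ricciEigenvalue (isotropyRoot_sq hΓ) hw, ← sum_curvature _ _ _ hD]
    rfl
  · intro x hx i j a
    have h := hlin x hx (frame k₁ k₂ a) i j
    rw [hskew x hx i, hskew x hx j, ip_bracket_skewMatrix_frame] at h
    refine h.trans ?_
    simp only [Matrix.mul_apply, mul_assoc]
    ring
  · intro x hx i j
    have h := hlin x hx (isotropyGen k₁ k₂) i j
    rw [hskew x hx i, hskew x hx j, ip_bracket_skewMatrix_isotropyGen] at h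
    have hs := P.smoothAt_lift hx
    have hdiv : ∀ i j, partialDeriv i (fun y => isotropyForm k₁ k₂ P.lift y j) x
        = partialDeriv i (fun y => ip (maurerCartan P.lift y (Pi.single j 1))
          (isotropyGen k₁ k₂)) x / Gam k₁ k₂ := fun i j => by
      have hd : DifferentiableAt ℝ (fun y => ip (maurerCartan P.lift y (Pi.single j 1))
          (isotropyGen k₁ k₂)) x :=
        (MatSmoothAt.linear (ipLinear _) (smoothAt_maurerCartan hs _)).differentiableAt (by simp)
      simp only [partialDeriv, isotropyForm, div_eq_mul_inv]
      rw [fderiv_mul_const hd, _root_.smul_apply, smul_eq_mul, mul_comm]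
    rw [hdiv, hdiv, ← sub_div, h, neg_div, Finset.sum_div]
    refine congrArg _ (Finset.sum_congr rfl fun b _ => ?_)
    rw [Finset.sum_div]
    exact Finset.sum_congr rfl fun d _ => by
      rw [Matrix.of_apply]
      ring

end MaurerCartan

end AloffWallach

namespace AloffWallach

open Filter Topology Matrix

/-! ### Curves in `SU(3)` with prescribed velocity -/

section Existence

/-- A smooth curve in `SU(3)` through `1` with velocity `X`. -/
def IsCurveWithVelocity (G : ℝ → SU3) (X : Mat3) : Prop :=
  (∀ i j, ContDiff ℝ ∞ fun y => ((G y : SU3) : Mat3) i j) ∧ G 0 = 1 ∧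
    ∀ i j, HasDerivAt (fun y => ((G y : SU3) : Mat3) i j) (X i j) 0

/-- The exponential `exp (y e)` of a skew-Hermitian matrix with `e ^ 3 = -e`. -/
noncomputable def planeRotation (e : Mat3) (y : ℝ) : Mat3 :=
  1 + Real.sin y • e + (1 - Real.cos y) • (e * e)

theorem exists_curve_planeRotation {e : Mat3} (he : eᴴ = -e) (h3 : e * e * e = -e)
    (hdet : ∀ y, (planeRotation e y).det = 1) : ∃ G, IsCurveWithVelocity G e := by
  have hconj : ∀ y, (planeRotation e y)ᴴ
      = 1 - Real.sin y • e + (1 - Real.cos y) • (e * e) := fun y => by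
    simp [planeRotation, he, sub_eq_add_neg]
  have hmem : ∀ y, planeRotation e y ∈ Matrix.specialUnitaryGroup (Fin 3) ℂ := fun y => by
    refine Matrix.mem_specialUnitaryGroup_iff.2 ⟨Matrix.mem_unitaryGroup_iff.2 ?_, hdet y⟩
    rw [Matrix.star_eq_conjTranspose, hconj, planeRotation]
    have h4 : e * e * (e * e) = -(e * e) := by rw [← mul_assoc, h3, neg_mul]
    have h3' : e * (e * e) = -e := by rw [← mul_assoc, h3]
    simp only [mul_add, add_mul, mul_sub, Matrix.smul_mul, Matrix.mul_smul, one_mul, mul_one,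
      h3, h3', h4, smul_neg]
    have hsc : Real.sin y * Real.sin y = 1 - Real.cos y * Real.cos y := by
      linarith [Real.sin_sq_add_cos_sq y, sq (Real.sin y), sq (Real.cos y)]
    have : (Real.sin y • Real.sin y • (e * e)) = (1 - Real.cos y * Real.cos y) • (e * e) := by
      rw [smul_smul, hsc]
    rw [this]
    module
  refine ⟨fun y => ⟨planeRotation e y, hmem y⟩, fun i j => ?_, ?_, fun i j => ?_⟩
  · simp only [planeRotation, Matrix.add_apply, Matrix.smul_apply]
    exact (contDiff_const.add (Real.contDiff_sin.smul contDiff_const)).add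
      ((contDiff_const.sub Real.contDiff_cos).smul contDiff_const)
  · apply Subtype.ext
    simp [planeRotation]
  · simp only [planeRotation, Matrix.add_apply, Matrix.smul_apply]
    have h := (((hasDerivAt_const (0 : ℝ) ((1 : Mat3) i j)).fun_add
      ((Real.hasDerivAt_sin 0).smul_const (e i j))).fun_add
      (((hasDerivAt_const (0 : ℝ) (1 : ℝ)).fun_sub (Real.hasDerivAt_cos 0)).smul_const ((e * e) i j)))
    simpa using h

/-- The relation `e ^ 3 = -e` used for the other six frame vectors is not available for general
`k₁`, `k₂`, but a diagonal matrix is exponentiated entrywise; the determinant is `1` because the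
exponents sum to zero. -/
theorem exists_curve_matT (k₁ k₂ : ℕ) : ∃ G, IsCurveWithVelocity G (matT k₁ k₂) := by
  set q : ℝ := 1 / Real.sqrt (3 * Gam k₁ k₂) with hq
  set d : Fin 3 → ℝ := ![q * (k₁ - k₂), q * (2 * k₂ + k₁), -(q * (2 * k₁ + k₂))] with hd
  have hmem : ∀ y : ℝ, (Matrix.diagonal fun a => ((Circle.exp (y * d a) : Circle) : ℂ))
      ∈ Matrix.specialUnitaryGroup (Fin 3) ℂ := fun y => by
    refine Matrix.mem_specialUnitaryGroup_iff.2 ⟨Matrix.mem_unitaryGroup_iff.2 ?_, ?_⟩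
    · rw [Matrix.star_eq_conjTranspose, Matrix.diagonal_conjTranspose,
        Matrix.diagonal_mul_diagonal, ← Matrix.diagonal_one]
      congr 1
      funext a
      simp only [Pi.star_apply, RCLike.star_def, Complex.mul_conj, Complex.normSq_eq_norm_sq,
        Circle.norm_coe, one_pow, Complex.ofReal_one]
    · rw [Matrix.det_diagonal, Fin.prod_univ_three]
      simp only [← Circle.coe_mul, ← Circle.exp_add]
      rw [show y * d 0 + y * d 1 + y * d 2 = 0 by simp [hd]; ring, Circle.exp_zero,
        Circle.coe_one]
  have hT : ∀ a, matT k₁ k₂ a a = d a * Complex.I := fun a => by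
    rw [matT, ← hq]
    clear_value q
    fin_cases a <;> simp [hd] <;> ring
  refine ⟨fun y => ⟨_, hmem y⟩, fun i j => ?_, ?_, fun i j => ?_⟩
  · by_cases hij : i = j
    · subst hij
      simp only [Matrix.diagonal_apply_eq, Circle.coe_exp, Complex.ofReal_mul]
      exact Complex.contDiff_exp.comp
        (((Complex.ofRealCLM.contDiff).mul contDiff_const).mul contDiff_const)
    · simp only [Matrix.diagonal_apply_ne _ hij]
      exact contDiff_const
  · apply Subtype.ext
    simp
  · by_cases hij : i = j
    · subst hij
      simp only [Matrix.diagonal_apply_eq, Circle.coe_exp, Complex.ofReal_mul, hT]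
      have h := (((Complex.ofRealCLM.hasDerivAt (x := (0 : ℝ))).mul_const (d i : ℂ)).mul_const
        Complex.I).cexp
      simpa using h
    · simp only [Matrix.diagonal_apply_ne _ hij, matT, Matrix.smul_apply, smul_zero]
      exact hasDerivAt_const _ _

theorem exists_curve_frame (k₁ k₂ : ℕ) (a : Fin 7) :
    ∃ G, IsCurveWithVelocity G (frame k₁ k₂ a) := by
  have hsc : ∀ y : ℝ, (Real.sin y : ℂ) ^ 2 = 1 - (Real.cos y : ℂ) ^ 2 := fun y => by
    rw [← Complex.ofReal_pow, Real.sin_sq]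
    simp
  have hE12 : matE 1 2 = !![0, 0, 0; 0, 0, 1; 0, -1, 0] := by
    ext i j
    fin_cases i <;> fin_cases j <;> simp [matE]
  have hE02 : matE 0 2 = !![0, 0, 1; 0, 0, 0; -1, 0, 0] := by
    ext i j
    fin_cases i <;> fin_cases j <;> simp [matE]
  have hE01 : matE 0 1 = !![0, 1, 0; -1, 0, 0; 0, 0, 0] := by
    ext i j
    fin_cases i <;> fin_cases j <;> simp [matE]
  have hF12 : matF 1 2 = !![0, 0, 0; 0, 0, Complex.I; 0, Complex.I, 0] := by
    ext i j
    fin_cases i <;> fin_cases j <;> simp [matF]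
  have hF02 : matF 0 2 = !![0, 0, Complex.I; 0, 0, 0; Complex.I, 0, 0] := by
    ext i j
    fin_cases i <;> fin_cases j <;> simp [matF]
  have hF01 : matF 0 1 = !![0, Complex.I, 0; Complex.I, 0, 0; 0, 0, 0] := by
    ext i j
    fin_cases i <;> fin_cases j <;> simp [matF]
  fin_cases a
  · exact exists_curve_matT k₁ k₂
  all_goals
    refine exists_curve_planeRotation ?_ ?_ fun y => ?_
    all_goals simp only [frame, Fin.mk_one, Fin.reduceFinMk, Matrix.cons_val, hE12, hE02, hE01,
      hF12, hF02, hF01]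
    · ext i j
      fin_cases i <;> fin_cases j <;> simp
    · ext i j
      fin_cases i <;> fin_cases j <;> simp
    · have h := hsc y
      simp [planeRotation, Matrix.det_fin_three] at h ⊢
      ring_nf
      simp only [Complex.I_sq, h]
      ring

end Existence

end AloffWallach

namespace AloffWallach

open Filter Topology Matrix

/-! ### A local parametrization, and uniqueness of the eigenvalues -/

section LocalParametrization

theorem matDeriv_mul_of_eq_one {V : Type*} [NormedAddCommGroup V] [NormedSpace ℝ V]
    {M N : V → Mat3} {x : V} (hM : MatSmoothAt M x) (hN : MatSmoothAt N x) (hM1 : M x = 1)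
    (hN1 : N x = 1) (v : V) :
    matDeriv v (fun y => M y * N y) x = matDeriv v M x + matDeriv v N x := by
  rw [matDeriv_mul hM hN, hM1, hN1, one_mul, mul_one]

/-- A map into `SU(3)` whose velocities at the origin are the frame vectors. -/
theorem exists_smooth_map_frame (k₁ k₂ : ℕ) : ∃ φ : (Fin 7 → ℝ) → SU3,
    (∀ x, MatSmoothAt (fun y => ((φ y : SU3) : Mat3)) x) ∧ φ 0 = 1 ∧
      ∀ v, matDeriv v (fun y => ((φ y : SU3) : Mat3)) 0 = ∑ a, v a • frame k₁ k₂ a := by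
  choose G hG hG0 hGd using exists_curve_frame k₁ k₂
  have hs : ∀ a x, MatSmoothAt (fun y : Fin 7 → ℝ => ((G a (y a) : SU3) : Mat3)) x :=
    fun a x i j => (hG a i j).contDiffAt.comp x (contDiff_apply ℝ ℝ a).contDiffAt
  have hd : ∀ a v, matDeriv v (fun y : Fin 7 → ℝ => ((G a (y a) : SU3) : Mat3)) 0
      = v a • frame k₁ k₂ a := fun a v => by
    ext i j
    have h : HasFDerivAt (fun y : Fin 7 → ℝ => y a)
        (ContinuousLinearMap.proj (R := ℝ) (φ := fun _ : Fin 7 => ℝ) a) 0 :=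
      (ContinuousLinearMap.proj (R := ℝ) (φ := fun _ : Fin 7 => ℝ) a).hasFDerivAt
    have h2 := HasFDerivAt.comp (0 : Fin 7 → ℝ) (hGd a i j).hasFDerivAt h
    exact DFunLike.congr_fun h2.fderiv v
  have h1 : ∀ a, ((G a ((0 : Fin 7 → ℝ) a) : SU3) : Mat3) = 1 := fun a => by
    rw [Pi.zero_apply, hG0, OneMemClass.coe_one]
  set M : Fin 7 → (Fin 7 → ℝ) → Mat3 := fun a y => ((G a (y a) : SU3) : Mat3) with hM
  -- Every factor equals `1` at the origin, so by the product rule the velocities add.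
  have key : ∀ l : List (Fin 7),
      (∀ x, MatSmoothAt (fun y => (l.map fun a => M a y).prod) x)
        ∧ (l.map fun a => M a 0).prod = 1
        ∧ ∀ v, matDeriv v (fun y => (l.map fun a => M a y).prod) 0
          = (l.map fun a => v a • frame k₁ k₂ a).sum := by
    intro l
    induction l with
    | nil => exact ⟨fun x => matSmoothAt_const _ x, rfl, fun v => matDeriv_const _ _ _⟩
    | cons a l ih =>
      obtain ⟨ih1, ih2, ih3⟩ := ih
      simp only [List.map_cons, List.prod_cons, List.sum_cons]
      exact ⟨fun x => (hs a x).mul (ih1 x), by rw [ih2, mul_one]; exact h1 a,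
        fun v => by rw [matDeriv_mul_of_eq_one (hs a 0) (ih1 0) (h1 a) ih2, hd, ih3]⟩
  have hcoe : ∀ y, (((List.finRange 7).map fun a => G a (y a)).prod : SU3).1
      = ((List.finRange 7).map fun a => M a y).prod := fun y => by
    rw [Submonoid.coe_list_prod, List.map_map]
    rfl
  refine ⟨fun y => ((List.finRange 7).map fun a => G a (y a)).prod, ?_, ?_, ?_⟩
  · simpa only [hcoe] using (key (List.finRange 7)).1
  · apply Subtype.ext
    rw [hcoe, (key _).2.1]
    rfl
  · intro v
    simp only [hcoe]
    rw [(key _).2.2, ← List.ofFn_eq_map, List.sum_ofFn]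

/-- The isotropy generator is orthogonal to the frame. Hence an invertible coframe matrix implies
the immersion condition. -/
theorem coframeMatrix_mulVec_eq_zero {n : ℕ} {k₁ k₂ : ℕ} {φ : (Fin n → ℝ) → SU3}
    {x v : Fin n → ℝ} (h : maurerCartan φ x v ∈ isotropy k₁ k₂) :
    coframeMatrix k₁ k₂ φ x *ᵥ v = 0 := by
  obtain ⟨c, hc⟩ := Submodule.mem_span_singleton.1 h
  ext a
  rw [coframeMatrix_mulVec, ← hc, ip_smul_left, ip_frame]
  fin_cases a <;> simp [kvec]
  right
  right
  ring

/-- A local parametrization around the origin. -/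
theorem exists_localParam {k₁ k₂ : ℕ} (hΓ : 0 < Gam k₁ k₂) :
    ∃ P : LocalParam k₁ k₂, (0 : Fin 7 → ℝ) ∈ P.source := by
  obtain ⟨φ, hs, h1, hd⟩ := exists_smooth_map_frame k₁ k₂
  have hcont : Continuous fun x => (coframeMatrix k₁ k₂ φ x).det :=
    continuous_iff_continuousAt.2 fun x => (MatSmoothAt.det fun a i =>
      MatSmoothAt.linear (ipLinear _) (smoothAt_maurerCartan (hs x) _)).continuousAt
  refine ⟨{ source := {x | (coframeMatrix k₁ k₂ φ x).det ≠ 0}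
            isOpen_source := isOpen_ne_fun hcont continuous_const
            toFun := fun x => QuotientGroup.mk (φ x)
            lift := φ
            lift_spec := fun _ _ => rfl
            smooth := fun a b x _ => (hs x a b).contDiffWithinAt
            immersion := fun x hx v hv => ?_ }, ?_⟩
  · exact Matrix.eq_zero_of_mulVec_eq_zero hx (coframeMatrix_mulVec_eq_zero hv)
  -- The velocities at the origin are the orthonormal frame itself.
  · have : coframeMatrix k₁ k₂ φ 0 = 1 := by
      ext a i
      rw [coframeMatrix, Matrix.of_apply, maurerCartan_eq, hd, h1, OneMemClass.coe_one,
        Matrix.conjTranspose_one, one_mul,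
        Finset.sum_eq_single_of_mem i (Finset.mem_univ i) fun b _ hb => by
          rw [Pi.single_eq_of_ne hb, zero_smul],
        Pi.single_eq_same, one_smul, ip_comm, ip_frame_frame hΓ]
    rw [Set.mem_ofPred_eq, this, Matrix.det_one]
    exact one_ne_zero

/-- The coframe matrix is invertible, so it can be cancelled on both sides of the diagonal matrix of
weights. -/
theorem coordMatrix_injective {k₁ k₂ : ℕ} (hΓ : 0 < Gam k₁ k₂) (P : LocalParam k₁ k₂)
    {x : Fin 7 → ℝ} (hx : x ∈ P.source) {c d : Fin 4 → ℝ}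
    (h : P.coordMatrix c x = P.coordMatrix d x) : c = d := by
  have hdet := (det_coframeMatrix_ne_zero hΓ P hx).isUnit
  rw [coordMatrix_eq hΓ, coordMatrix_eq hΓ] at h
  have h1 := congrArg (· * (coframeMatrix k₁ k₂ P.lift x)⁻¹) h
  simp only [Matrix.mul_nonsing_inv_cancel_right _ _ hdet] at h1
  have h2 := congrArg (((coframeMatrix k₁ k₂ P.lift x)ᵀ)⁻¹ * ·) h1
  have hdetT : IsUnit (coframeMatrix k₁ k₂ P.lift x)ᵀ.det := by rwa [Matrix.det_transpose]
  simp only [Matrix.nonsing_inv_mul_cancel_left _ _ hdetT] at h2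
  have h3 := Matrix.diagonal_injective h2
  ext a
  fin_cases a
  -- One frame index from each of the four summands.
  exacts [congrFun h3 0, congrFun h3 1, congrFun h3 3, congrFun h3 5]

theorem isRicciEigenvalues_iff {k₁ k₂ : ℕ} (hΓ : 0 < Gam k₁ k₂) {t : ℝ} {s : Fin 3 → ℝ}
    (ht : 0 < t) (hs : ∀ i, 0 < s i) (r : Fin 4 → ℝ) :
    IsRicciEigenvalues k₁ k₂ t s r
      ↔ r = ricciEigenvalue (frameRoot k₁ k₂) ![t, s 0, s 1, s 2] := by
  set w : Fin 4 → ℝ := ![t, s 0, s 1, s 2] with hwdef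
  have hw : ∀ a, w a ≠ 0 := fun a => by
    fin_cases a
    exacts [ht.ne', (hs 0).ne', (hs 1).ne', (hs 2).ne']
  have hr : ![t * r 0, s 0 * r 1, s 1 * r 2, s 2 * r 3] = fun a => w a * r a := by
    ext a
    fin_cases a <;> rfl
  simp only [IsRicciEigenvalues, LocalParam.metric, ← hwdef, hr]
  constructor
  · intro h
    -- Without a parametrization the hypothesis would be vacuous; one point of one parametrization
    -- already determines `r`.
    obtain ⟨P, hP⟩ := exists_localParam hΓ
    have h1 := coordMatrix_injective hΓ P hP (c := fun a => w a * r a)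
      (d := fun a => w a * ricciEigenvalue (frameRoot k₁ k₂) w a) (by
        ext i j
        rw [← h P 0 hP, ricci_metric_eq hΓ hw P hP])
    ext a
    exact mul_left_cancel₀ (hw a) (congrFun h1 a)
  · rintro rfl P x hx i j
    exact ricci_metric_eq hΓ hw P hx i j

theorem frameRoot_sq {k₁ k₂ : ℕ} (hΓ : 0 < Gam k₁ k₂) :
    frameRoot k₁ k₂ 0 ^ 2 = 3 * ((k₁ : ℝ) + k₂) ^ 2 / Gam k₁ k₂ ∧
      frameRoot k₁ k₂ 1 ^ 2 = 3 * (k₁ : ℝ) ^ 2 / Gam k₁ k₂ ∧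
      frameRoot k₁ k₂ 2 ^ 2 = 3 * (k₂ : ℝ) ^ 2 / Gam k₁ k₂ := by
  have hq : (1 / Real.sqrt (3 * Gam k₁ k₂)) ^ 2 = 1 / (3 * Gam k₁ k₂) := by
    rw [eq_div_iff (by positivity), inv_sqrt_sq hΓ]
  have hne := hΓ.ne'
  refine ⟨?_, ?_, ?_⟩ <;>
    simp only [frameRoot, Matrix.cons_val, mul_pow, neg_sq, hq] <;> field_simp

end LocalParametrization

end AloffWallach
-- The stated formulas, by substituting the squared weights
theorem mainTheorem7 (k₁ k₂ : ℕ) (hle : k₁ ≤ k₂) (hgcd : Nat.gcd k₁ k₂ = 1)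
    (t : ℝ) (s : Fin 3 → ℝ) (ht : 0 < t) (hs : ∀ i, 0 < s i)
    (r : Fin 4 → ℝ) :
    AloffWallach.IsRicciEigenvalues k₁ k₂ t s r ↔
      r 0 = 3 * t / (2 * AloffWallach.Gam k₁ k₂) *
          (((k₁ : ℝ) + k₂) ^ 2 / s 0 ^ 2 + (k₁ : ℝ) ^ 2 / s 1 ^ 2 + (k₂ : ℝ) ^ 2 / s 2 ^ 2) ∧
      r 1 = 6 / s 0 - 3 * ((k₁ : ℝ) + k₂) ^ 2 * t / (2 * AloffWallach.Gam k₁ k₂ * s 0 ^ 2) +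
          (s 0 / (s 1 * s 2) - s 1 / (s 0 * s 2) - s 2 / (s 0 * s 1)) ∧
      r 2 = 6 / s 1 - 3 * (k₁ : ℝ) ^ 2 * t / (2 * AloffWallach.Gam k₁ k₂ * s 1 ^ 2) +
          (s 1 / (s 0 * s 2) - s 0 / (s 1 * s 2) - s 2 / (s 0 * s 1)) ∧
      r 3 = 6 / s 2 - 3 * (k₂ : ℝ) ^ 2 * t / (2 * AloffWallach.Gam k₁ k₂ * s 2 ^ 2) +
          (s 2 / (s 0 * s 1) - s 0 / (s 1 * s 2) - s 1 / (s 0 * s 2)) := by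
  have hΓ := AloffWallach.Gam_pos hgcd
  obtain ⟨h0, h1, h2⟩ := AloffWallach.frameRoot_sq hΓ
  have e0 : AloffWallach.ricciEigenvalue (AloffWallach.frameRoot k₁ k₂) ![t, s 0, s 1, s 2] 0
      = 3 * t / (2 * AloffWallach.Gam k₁ k₂) * (((k₁ : ℝ) + k₂) ^ 2 / s 0 ^ 2
        + (k₁ : ℝ) ^ 2 / s 1 ^ 2 + (k₂ : ℝ) ^ 2 / s 2 ^ 2) := by
    simp only [AloffWallach.ricciEigenvalue, Matrix.cons_val, h0, h1, h2]
    field_simp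
  have hterm : ∀ k x : ℝ, 3 * k ^ 2 / AloffWallach.Gam k₁ k₂ * t / (2 * x ^ 2)
      = 3 * k ^ 2 * t / (2 * AloffWallach.Gam k₁ k₂ * x ^ 2) := fun k x => by
    rw [div_mul_eq_mul_div, div_div]
    congr 1
    ring
  rw [AloffWallach.isRicciEigenvalues_iff hΓ ht hs, funext_iff, Fin.forall_fin_succ,
    Fin.forall_fin_succ, Fin.forall_fin_succ, Fin.forall_fin_succ]
  simp only [Fin.succ_zero_eq_one, Fin.succ_one_eq_two, IsEmpty.forall_iff, and_true]
  rw [e0]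
  simp only [AloffWallach.ricciEigenvalue, h0, h1, h2, ← hterm]
  exact Iff.rfl
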